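/- Consider the following calculi; expressions are taken up to $\alpha$-conversion, and there are two disjoint kinds of variables, ordinary variables $x,y,z,\dots$ and continuation variables $k,l,\dots$. **The CCV $\lambda\mu$-calculus.** Terms $M$ and jumps $J$ are given by $$M ::= x \mid \lambda x.\,M \mid M\,M \mid M\langle x:=M\rangle \mid \mu k.\,J,\qquad J ::= [k]M \mid J\langle x:=M\rangle ,$$ where $\lambda x$ and $\mu k$ bind as usual and $L\langle x:=M\rangle$ (a let-expression) binds $x$ in $L$ (a term or a jump) but not in $M$. Values $V$ are the terms of the form $x$ or $\lambda x.\,M$. Syntax trees are identified modulo the congruence generated by $$L\langle x:=M\langle y:=N\rangle\rangle = L\langle x:=M\rangle\langle y:=N\rangle\ (y\notin FV(L)),$$ $$(\mu k.\,J)\langle x:=M\rangle=\mu k.\,(J\langle x:=M\rangle)\ (k\notin FV(M)),\qquad [k](L\langle x:=M\rangle)=([k]L)\langle x:=M\rangle ,$$ so that CCV terms are congruence classes of syntax trees. Reduction $\to$ on CCV terms applies one of the following rules to an arbitrary subexpression of an arbitrary representative ($V$ a value, $z$ fresh): - $NM\to (zM)\langle z:=N\rangle$ if $N$ is not a value; $VN\to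 (Vz)\langle z:=N\rangle$ if $N$ is not a value; - $(\lambda x.\,M)V\to M\langle x:=V\rangle$; $\ M\langle x:=V\rangle\to M\{V/x\}$; - $M\langle x:=\mu k.\,J\rangle\to\mu k.\,J\{[k]\square\mapsto[k]M\langle x:=\square\rangle\}$, where every $[k]Q$ in $J$ with $k$ free in $J$ is replaced, recursively, by $[k]M\langle x:=Q\rangle$; $\ [l]\mu k.\,J\to J\{l/k\}$; - $\lambda x.\,Vx\to V$ if $x\notin FV(V)$; $\ x\langle x:=M\rangle\to M$; $\ \mu k.\,[k]M\to M$ if $k\notin FV(M)$. The last rule, $(\eta_\mu)$, is called vertical. $M^{\downarrow}$ denotes the normal form of $M$ with respect to vertical reductions. **The target calculus** has four sorts of expressions, $$T ::= \lambda k.\,Q\mid WW,\quad Q ::= KW\mid TK,\quad W ::= x\mid\lambda x.\,T,\quad K ::= k\mid\lambda x.\,Q ,$$ with ordinary $\beta\eta$-reduction at any position. **CPS translation.** On syntax trees define ($V,V_i$ values, $N,N_i$ non-values, all newly bound variables fresh) $$\lfloor V\rfloor[K]=KV^*,\quad \lfloor V_1V_2\rfloor[K]=V_1^*V_2^*K,\quad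 \lfloor VN\rfloor[K]=\lfloor N\rfloor[\lambda y.\,V^*yK],$$ $$\lfloor NV\rfloor[K]=\lfloor N\rfloor[\lambda x.\,xV^*K],\quad \lfloor N_1N_2\rfloor[K]=\lfloor N_1\rfloor[\lambda x.\,\lfloor N_2\rfloor[\lambda y.\,xyK]],$$ $$\lfloor L\langle x:=M\rangle\rfloor[K]=\lfloor M\rfloor[\lambda x.\,\lfloor L\rfloor[K]]\ (x\notin FV(K)),\quad \lfloor\mu k.\,J\rfloor[K]=(\lambda k.\,\lfloor J\rfloor)K,$$ $$\lfloor[k]M\rfloor=\lfloor M\rfloor[k],\quad \lfloor J\langle x:=M\rangle\rfloor=\lfloor M\rfloor[\lambda x.\,\lfloor J\rfloor],\quad x^*=x,\quad(\lambda x.\,M)^*=\lambda xk.\,\lfloor M\rfloor[k],$$ and $[\![M]\!]=\lambda k.\,\lfloor M\rfloor[k]$. This depends on the syntax tree that represents $M$. **Inverse translation.** $(\lambda k.\,Q)^{-1}=\mu k.\,Q^{-1}$, $(W_1W_2)^{-1}=W_1^{-1}W_2^{-1}$, $(KW)^{-1}=K^{-1}[W^{-1}]$, $(TK)^{-1}=K^{-1}[T^{-1}]$,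 $x^{-1}=x$, $(\lambda x.\,T)^{-1}=\lambda x.\,T^{-1}$, where $K^{-1}$ is a jump with a hole: $k^{-1}=[k]\square$ and $(\lambda x.\,Q)^{-1}=Q^{-1}\langle x:=\square\rangle$. **Theorem (sharpened completeness).** Let $M$ be a CCV $\lambda\mu$-term, given by an arbitrarily chosen representing syntax tree, and let $[\![M]\!]$ be the CPS translation of that tree. If $[\![M]\!]\to^* N$ by $\beta\eta$-reduction in the target calculus, then $N^{-1}$ has exactly one normal form $(N^{-1})^{\downarrow}$ with respect to vertical reductions, and $M\to^*(N^{-1})^{\downarrow}$ in the CCV $\lambda\mu$-calculus. -/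

import Mathlib

namespace CCV

/-! Both calculi are represented with de Bruijn indices, so that `α`-convertible expressions are
identical.  Ordinary variables and continuation variables live in two separate index spaces:
`λx` and `let` shift the ordinary indices, `μk` (and `λk` in the target calculus) shift the
continuation indices. -/

/-- Lifting of a renaming under one binder. -/
def lift (ρ : ℕ → ℕ) : ℕ → ℕ
  | 0 => 0
  | n + 1 => ρ n + 1

/-! ### Syntax of the source calculus -/

/-- Syntactic classes of the source: values, terms (which include the values) and jumps. -/
inductive SrcSort : Type
  | val
  | term
  | jump

/-- Syntax trees of the CCV `λμ`-calculus:
`V ::= x | λx.M`,  `M ::= V | M M | M⟨x := M⟩ | μk.J`,  `J ::= [k]M | J⟨x := M⟩`.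
In `letT L M = L⟨x := M⟩` and `letJ J M = J⟨x := M⟩` the ordinary index `0` of the first argument
is bound. -/
inductive Src : SrcSort → Type
  | var : ℕ → Src .val
  | lam : Src .term → Src .val
  | ofVal : Src .val → Src .term
  | app : Src .term → Src .term → Src .term
  | letT : Src .term → Src .term → Src .term
  | mu : Src .jump → Src .term
  | jmp : ℕ → Src .term → Src .jump
  | letJ : Src .jump → Src .term → Src .jump

namespace Src

/-- Renaming of the free ordinary variables by `ρ` and of the free continuation variables
by `κ`. -/
def rename : {s : SrcSort} → (ℕ → ℕ) → (ℕ → ℕ) → Src s → Src s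
  | _, ρ, _, var x => var (ρ x)
  | _, ρ, κ, lam M => lam (M.rename (lift ρ) κ)
  | _, ρ, κ, ofVal V => ofVal (V.rename ρ κ)
  | _, ρ, κ, app M N => app (M.rename ρ κ) (N.rename ρ κ)
  | _, ρ, κ, letT L M => letT (L.rename (lift ρ) κ) (M.rename ρ κ)
  | _, ρ, κ, mu J => mu (J.rename ρ (lift κ))
  | _, ρ, κ, jmp k M => jmp (κ k) (M.rename ρ κ)
  | _, ρ, κ, letJ J M => letJ (J.rename (lift ρ) κ) (M.rename ρ κ)

/-- Weakening by a fresh ordinary variable (which gets index `0`). -/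
def wk {s : SrcSort} (M : Src s) : Src s := M.rename Nat.succ id

/-- Weakening by a fresh ordinary variable that gets index `1`, below the innermost one. -/
def wk₁ {s : SrcSort} (M : Src s) : Src s := M.rename (lift Nat.succ) id

/-- Weakening by a fresh continuation variable (which gets index `0`). -/
def wkC {s : SrcSort} (M : Src s) : Src s := M.rename id Nat.succ

/-- Lifting of a substitution under a binder of an ordinary variable. -/
def liftSubst (σ : ℕ → Src .val) : ℕ → Src .val
  | 0 => var 0
  | n + 1 => (σ n).wk

/-- Simultaneous capture-avoiding substitution of values for ordinary variables. -/
def subst : {s : SrcSort} → (ℕ → Src .val) → Src s → Src s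
  | _, σ, var x => σ x
  | _, σ, lam M => lam (M.subst (liftSubst σ))
  | _, σ, ofVal V => ofVal (V.subst σ)
  | _, σ, app M N => app (M.subst σ) (N.subst σ)
  | _, σ, letT L M => letT (L.subst (liftSubst σ)) (M.subst σ)
  | _, σ, mu J => mu (J.subst (fun n => (σ n).wkC))
  | _, σ, jmp k M => jmp k (M.subst σ)
  | _, σ, letJ J M => letJ (J.subst (liftSubst σ)) (M.subst σ)

/-- `M{V/x}`, where `x` is the ordinary variable of index `0`. -/
def inst {s : SrcSort} (M : Src s) (V : Src .val) : Src s :=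
  M.subst fun
    | 0 => V
    | n + 1 => var n

/-- The context substitution `E{[k]□ ↦ [k]L⟨x := □⟩}`; the ordinary index `0` of `L` is the
variable `x` bound by the inserted `let`. -/
def ctxSubst : {s : SrcSort} → ℕ → Src .term → Src s → Src s
  | _, _, _, var x => var x
  | _, k, L, lam M => lam (ctxSubst k L.wk₁ M)
  | _, k, L, ofVal V => ofVal (ctxSubst k L V)
  | _, k, L, app M N => app (ctxSubst k L M) (ctxSubst k L N)
  | _, k, L, letT M N => letT (ctxSubst k L.wk₁ M) (ctxSubst k L N)
  | _, k, L, mu J => mu (ctxSubst (k + 1) L.wkC J)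
  | _, k, L, jmp l M =>
      if l = k then jmp l (letT L (ctxSubst k L M)) else jmp l (ctxSubst k L M)
  | _, k, L, letJ J N => letJ (ctxSubst k L.wk₁ J) (ctxSubst k L N)

/-- `J{l/k}`, where `k` is the continuation variable of index `0`. -/
def instC {s : SrcSort} (J : Src s) (l : ℕ) : Src s :=
  J.rename id fun
    | 0 => l
    | n + 1 => n

/-- A term is a value if it is a variable or a `λ`-abstraction. -/
def IsValue (M : Src .term) : Prop := ∃ V : Src .val, M = ofVal V

end Src

open Src

/-! ### Identification of terms, and reduction -/

/-- The compatible closure of a family of relations: `R` applied at one position of a term. -/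
inductive Compat (R : ∀ s : SrcSort, Src s → Src s → Prop) :
    ∀ s : SrcSort, Src s → Src s → Prop
  | root {s} {A B : Src s} : R s A B → Compat R s A B
  | lam {M M'} : Compat R .term M M' → Compat R .val (lam M) (lam M')
  | ofVal {V V'} : Compat R .val V V' → Compat R .term (ofVal V) (ofVal V')
  | appL {M M' N} : Compat R .term M M' → Compat R .term (app M N) (app M' N)
  | appR {M N N'} : Compat R .term N N' → Compat R .term (app M N) (app M N')
  | letTL {L L' M} : Compat R .term L L' → Compat R .term (letT L M) (letT L' M)
  | letTR {L M M'} : Compat R .term M M' → Compat R .term (letT L M) (letT L M')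
  | mu {J J'} : Compat R .jump J J' → Compat R .term (mu J) (mu J')
  | jmp {k M M'} : Compat R .term M M' → Compat R .jump (jmp k M) (jmp k M')
  | letJL {J J' M} : Compat R .jump J J' → Compat R .jump (letJ J M) (letJ J' M)
  | letJR {J M M'} : Compat R .term M M' → Compat R .jump (letJ J M) (letJ J M')

/-- The equality axioms.
* `assoc`: `L⟨x := M⟨y := N⟩⟩ = L⟨x := M⟩⟨y := N⟩` if `y ∉ L`;
* `muLet`: `(μk.J)⟨x := M⟩ = μk.(J⟨x := M⟩)` if `k ∉ M`;
* `jmpLet`: `[k](L⟨x := M⟩) = ([k]L)⟨x := M⟩`. -/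
inductive EqAxiom : ∀ s : SrcSort, Src s → Src s → Prop
  | assoc (L M N : Src .term) :
      EqAxiom .term (letT L (letT M N)) (letT (letT L.wk₁ M) N)
  | muLet (J : Src .jump) (M : Src .term) :
      EqAxiom .term (letT (mu J) M) (mu (letJ J M.wkC))
  | jmpLet (k : ℕ) (L M : Src .term) :
      EqAxiom .jump (jmp k (letT L M)) (letJ (jmp k L) M)

/-- The rule `(η_μ)`: `μk.[k]M → M` if `k ∉ M`. -/
inductive VerticalRule : ∀ s : SrcSort, Src s → Src s → Prop
  | etaMu (M : Src .term) : VerticalRule .term (mu (jmp 0 M.wkC)) M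

/-- The reduction rules of the CCV `λμ`-calculus. -/
inductive Rule : ∀ s : SrcSort, Src s → Src s → Prop
  /-- `N M → (z M)⟨z := N⟩`, `N` a non-value -/
  | ad₁ (N M : Src .term) : ¬ N.IsValue →
      Rule .term (app N M) (letT (app (ofVal (var 0)) M.wk) N)
  /-- `V N → (V z)⟨z := N⟩`, `N` a non-value -/
  | ad₂ (V : Src .val) (N : Src .term) : ¬ N.IsValue →
      Rule .term (app (ofVal V) N) (letT (app (ofVal V.wk) (ofVal (var 0))) N)
  /-- `(λx.M) V → M⟨x := V⟩` -/
  | betaLam (M : Src .term) (V : Src .val) :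
      Rule .term (app (ofVal (lam M)) (ofVal V)) (letT M (ofVal V))
  /-- `M⟨x := V⟩ → M{V/x}` -/
  | betaLet (M : Src .term) (V : Src .val) :
      Rule .term (letT M (ofVal V)) (M.inst V)
  /-- `M⟨x := μk.J⟩ → μk.J{[k]□ ↦ [k]M⟨x := □⟩}` -/
  | betaMu (M : Src .term) (J : Src .jump) :
      Rule .term (letT M (mu J)) (mu (ctxSubst 0 M.wkC J))
  /-- `[l]μk.J → J{l/k}` -/
  | betaJmp (l : ℕ) (J : Src .jump) :
      Rule .jump (jmp l (mu J)) (J.instC l)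
  /-- `λx.V x → V`, `x ∉ V` -/
  | etaLam (V : Src .val) :
      Rule .val (lam (app (ofVal V.wk) (ofVal (var 0)))) V
  /-- `x⟨x := M⟩ → M` -/
  | etaLet (M : Src .term) :
      Rule .term (letT (ofVal (var 0)) M) M
  /-- `μk.[k]M → M`, `k ∉ M` -/
  | etaMu {M M' : Src .term} : VerticalRule .term M M' → Rule .term M M'

/-- The congruence generated by the equality axioms. -/
def eqSetoid (s : SrcSort) : Setoid (Src s) := Relation.EqvGen.setoid (Compat EqAxiom s)

/-- Expressions of the CCV `λμ`-calculus: syntax trees up to the equality axioms. -/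
def Expr (s : SrcSort) : Type := Quotient (eqSetoid s)

/-- The expression denoted by a syntax tree. -/
def Expr.mk {s : SrcSort} (M : Src s) : Expr s := Quotient.mk (eqSetoid s) M

/-- One application of a rule of `R`, anywhere, in any representatives. -/
def StepOf (R : ∀ s : SrcSort, Src s → Src s → Prop) {s : SrcSort} (a b : Expr s) : Prop :=
  ∃ A B : Src s, Expr.mk A = a ∧ Expr.mk B = b ∧ Compat R s A B

/-- One-step reduction of the CCV `λμ`-calculus. -/
def Red {s : SrcSort} : Expr s → Expr s → Prop := StepOf Rule

/-- One-step vertical reduction. -/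
def Vertical {s : SrcSort} : Expr s → Expr s → Prop := StepOf VerticalRule

/-- `d` is a normal form of `a` with respect to vertical reductions. -/
def IsVerticalNF {s : SrcSort} (a d : Expr s) : Prop :=
  Relation.ReflTransGen Vertical a d ∧ ∀ e, ¬ Vertical d e

/-! ### The sorted target calculus -/

/-- Sorts of the target calculus: terms, jumps, values, continuations. -/
inductive TgtSort : Type
  | T
  | Q
  | W
  | K

/-- The target calculus:
`T ::= λk.Q | W W`,  `Q ::= K W | T K`,  `W ::= x | λx.T`,  `K ::= k | λx.Q`. -/
inductive Tgt : TgtSort → Type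
  | lamC : Tgt .Q → Tgt .T
  | appW : Tgt .W → Tgt .W → Tgt .T
  | appK : Tgt .K → Tgt .W → Tgt .Q
  | appT : Tgt .T → Tgt .K → Tgt .Q
  | var : ℕ → Tgt .W
  | lamW : Tgt .T → Tgt .W
  | cvar : ℕ → Tgt .K
  | lamK : Tgt .Q → Tgt .K

namespace Tgt

/-- Renaming of the free ordinary variables by `ρ` and of the free continuation variables
by `κ`. -/
def rename : {s : TgtSort} → (ℕ → ℕ) → (ℕ → ℕ) → Tgt s → Tgt s
  | _, ρ, κ, lamC Q => lamC (Q.rename ρ (lift κ))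
  | _, ρ, κ, appW V W => appW (V.rename ρ κ) (W.rename ρ κ)
  | _, ρ, κ, appK K W => appK (K.rename ρ κ) (W.rename ρ κ)
  | _, ρ, κ, appT T K => appT (T.rename ρ κ) (K.rename ρ κ)
  | _, ρ, _, var x => var (ρ x)
  | _, ρ, κ, lamW T => lamW (T.rename (lift ρ) κ)
  | _, _, κ, cvar k => cvar (κ k)
  | _, ρ, κ, lamK Q => lamK (Q.rename (lift ρ) κ)

/-- Weakening by a fresh ordinary variable (which gets index `0`). -/
def wk {s : TgtSort} (P : Tgt s) : Tgt s := P.rename Nat.succ id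

/-- Weakening by a fresh continuation variable (which gets index `0`). -/
def wkC {s : TgtSort} (P : Tgt s) : Tgt s := P.rename id Nat.succ

/-- Lifting of the ordinary part of a substitution under a binder of an ordinary variable. -/
def liftW (σ : ℕ → Tgt .W) : ℕ → Tgt .W
  | 0 => var 0
  | n + 1 => (σ n).wk

/-- Lifting of the continuation part of a substitution under a binder of a continuation
variable. -/
def liftK (τ : ℕ → Tgt .K) : ℕ → Tgt .K
  | 0 => cvar 0
  | n + 1 => (τ n).wkC

/-- Simultaneous capture-avoiding substitution of values for ordinary variables and of
continuations for continuation variables. -/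
def subst : {s : TgtSort} → (ℕ → Tgt .W) → (ℕ → Tgt .K) → Tgt s → Tgt s
  | _, σ, τ, lamC Q => lamC (Q.subst (fun n => (σ n).wkC) (liftK τ))
  | _, σ, τ, appW V W => appW (V.subst σ τ) (W.subst σ τ)
  | _, σ, τ, appK K W => appK (K.subst σ τ) (W.subst σ τ)
  | _, σ, τ, appT T K => appT (T.subst σ τ) (K.subst σ τ)
  | _, σ, _, var x => σ x
  | _, σ, τ, lamW T => lamW (T.subst (liftW σ) (fun n => (τ n).wk))
  | _, _, τ, cvar k => τ k
  | _, σ, τ, lamK Q => lamK (Q.subst (liftW σ) (fun n => (τ n).wk))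

/-- `P{W/x}`, where `x` is the ordinary variable of index `0`. -/
def instW {s : TgtSort} (P : Tgt s) (W : Tgt .W) : Tgt s :=
  P.subst (fun
    | 0 => W
    | n + 1 => var n) cvar

/-- `P{K/k}`, where `k` is the continuation variable of index `0`. -/
def instK {s : TgtSort} (P : Tgt s) (K : Tgt .K) : Tgt s :=
  P.subst var (fun
    | 0 => K
    | n + 1 => cvar n)

end Tgt

open Tgt in
/-- One-step `βη`-reduction in the target calculus, at any position. -/
inductive BetaEta : ∀ {s : TgtSort}, Tgt s → Tgt s → Prop
  | betaC (Q : Tgt .Q) (K : Tgt .K) : BetaEta (appT (lamC Q) K) (Q.instK K)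
  | betaW (T : Tgt .T) (W : Tgt .W) : BetaEta (appW (lamW T) W) (T.instW W)
  | betaK (Q : Tgt .Q) (W : Tgt .W) : BetaEta (appK (lamK Q) W) (Q.instW W)
  | etaC (T : Tgt .T) : BetaEta (lamC (appT T.wkC (cvar 0))) T
  | etaW (W : Tgt .W) : BetaEta (lamW (appW W.wk (var 0))) W
  | etaK (K : Tgt .K) : BetaEta (lamK (appK K.wk (var 0))) K
  | lamC {Q Q'} : BetaEta Q Q' → BetaEta (lamC Q) (lamC Q')
  | appWL {V V' W} : BetaEta V V' → BetaEta (appW V W) (appW V' W)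
  | appWR {V W W'} : BetaEta W W' → BetaEta (appW V W) (appW V W')
  | appKL {K K' W} : BetaEta K K' → BetaEta (appK K W) (appK K' W)
  | appKR {K W W'} : BetaEta W W' → BetaEta (appK K W) (appK K W')
  | appTL {T T' K} : BetaEta T T' → BetaEta (appT T K) (appT T' K)
  | appTR {T K K'} : BetaEta K K' → BetaEta (appT T K) (appT T K')
  | lamW {T T'} : BetaEta T T' → BetaEta (lamW T) (lamW T')
  | lamK {Q Q'} : BetaEta Q Q' → BetaEta (lamK Q) (lamK Q')

/-! ### CPS translation -/

/-- Size of a syntax tree. -/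
def Src.size : {s : SrcSort} → Src s → ℕ
  | _, var _ => 1
  | _, lam M => M.size + 1
  | _, ofVal V => V.size + 1
  | _, app M N => M.size + N.size + 1
  | _, letT L M => L.size + M.size + 1
  | _, mu J => J.size + 1
  | _, jmp _ M => M.size + 1
  | _, letJ J M => J.size + M.size + 1

theorem Src.size_rename {s : SrcSort} (M : Src s) :
    ∀ ρ κ : ℕ → ℕ, (M.rename ρ κ).size = M.size := by
  induction M <;> intro ρ κ <;> simp_all [Src.rename, Src.size]

theorem Src.size_wk {s : SrcSort} (M : Src s) : M.wk.size = M.size := M.size_rename _ _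

theorem Src.size_wkC {s : SrcSort} (M : Src s) : M.wkC.size = M.size := M.size_rename _ _

mutual

/-- `V*` for a value `V`. -/
def star : Src .val → Tgt .W
  | .var x => .var x
  | .lam M => .lamW (.lamC (colon M.wkC (.cvar 0)))
termination_by V => V.size
decreasing_by simp only [Src.size, Src.size_wkC]; omega

/-- `⌊M⌋[K]` for a term `M` and a continuation `K`.  In the clauses for applications, a pattern
that is not of the form `ofVal _` stands for a non-value. -/
def colon : Src .term → Tgt .K → Tgt .Q
  | .ofVal V, K => .appK K (star V)
  | .app (.ofVal V₁) (.ofVal V₂), K => .appT (.appW (star V₁) (star V₂)) K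
  | .app (.ofVal V) N, K =>
      colon N (.lamK (.appT (.appW (star V).wk (.var 0)) K.wk))
  | .app N (.ofVal V), K =>
      colon N (.lamK (.appT (.appW (.var 0) (star V).wk) K.wk))
  | .app N₁ N₂, K =>
      colon N₁ (.lamK (colon N₂.wk (.lamK (.appT (.appW (.var 1) (.var 0)) K.wk.wk))))
  | .letT L M, K => colon M (.lamK (colon L K.wk))
  | .mu J, K => .appT (.lamC (colonJ J)) K
termination_by M => M.size
decreasing_by all_goals (simp only [Src.size, Src.size_wk]; omega)

/-- `⌊J⌋` for a jump `J`. -/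
def colonJ : Src .jump → Tgt .Q
  | .jmp k M => colon M (.cvar k)
  | .letJ J M => colon M (.lamK (colonJ J))
termination_by J => J.size
decreasing_by all_goals (simp only [Src.size]; omega)

end

/-- The CPS translation `⟦M⟧ = λk.⌊M⌋[k]` of a syntax tree, `k` fresh. -/
def cps (M : Src .term) : Tgt .T := .lamC (colon M.wkC (.cvar 0))

/-! ### Inverse translation -/

/-- The kind of object that the inverse translation yields at each sort: terms, jumps, values, and
jumps with a hole to be filled with a term (which is never below a binder). -/
def InvTy : TgtSort → Type
  | .T => Src .term
  | .Q => Src .jump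
  | .W => Src .val
  | .K => Src .term → Src .jump

/-- The inverse translation. -/
def inv : {s : TgtSort} → Tgt s → InvTy s
  | _, .lamC Q => Src.mu (inv Q)
  | _, .appW W₁ W₂ => Src.app (Src.ofVal (inv W₁)) (Src.ofVal (inv W₂))
  | _, .appK K W => (inv K : Src .term → Src .jump) (Src.ofVal (inv W))
  | _, .appT T K => (inv K : Src .term → Src .jump) (inv T)
  | _, .var x => Src.var x
  | _, .lamW T => Src.lam (inv T)
  | _, .cvar k => fun M => Src.jmp k M
  | _, .lamK Q => fun M => Src.letJ (inv Q) M

/-- `N⁻¹` for a target term `N` of sort `T`, as a CCV term. -/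
def invTerm (N : Tgt .T) : Expr .term := Expr.mk (inv N : Src .term)

end CCV

namespace CCV

open Src

-- Vertical normal forms are computed by a function `nf` on syntax trees. It brings every jump to
-- the form `[k]M`, reassociates `let`s, moves them out of a `μ` as far as the bound variable
-- allows, and then contracts the `μ` if it is an `η_μ`-redex. It identifies the two sides of each
-- equality axiom and of `η_μ` (`nf_of_eqAxiom`, `nf_of_verticalRule`), and every tree reduces
-- vertically to its `nf` (`star_nf`). Since vertical steps lower the number of `μ`s, which the
-- axioms preserve, `nf` represents the only vertical normal form (`isVerticalNF_nf`,
-- `IsVerticalNF.eq_nf`).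
--
-- Completeness then has two halves. By `star_cps`, `M` reduces to `nf` of the inverse image of its
-- translation; by `invRed_of_betaEta`, each target step `A → B` yields a source reduction between
-- the normal forms of the inverse images. An induction on the target reduction combines them.
--
-- The obstacle in both halves is that the inverse translation creates redundant abstractions
-- `μk.[k]M`, which source reduction can remove but not introduce. `Star.nf_mu` overcomes it: if `k`
-- is not free in `M` and `[k]M` reduces to `J`, then `M` itself reduces to the normal form of
-- `μk.J`. Either the head `k` survives and the `μ` is contracted again, or at some moment the head
-- `[k]` met a `μ` coming from `M`, which then serves as the outer `μ`.
--
-- Reductions are handled on trees by `Star`, in which the axioms count as steps; `Star.stepOf`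
-- passes to congruence classes.

@[simp] theorem lift_id : lift id = id := by
  funext n; cases n <;> rfl

theorem lift_comp (f g : ℕ → ℕ) : lift f ∘ lift g = lift (f ∘ g) := by
  funext n; cases n <;> rfl

theorem lift_eq_zero {κ : ℕ → ℕ} {j : ℕ} : lift κ j = 0 ↔ j = 0 := by
  cases j <;> simp [lift]

namespace Src

/-! ### Renaming -/

theorem rename_id {s : SrcSort} (M : Src s) : M.rename id id = M := by
  induction M <;> simp_all [rename]

theorem rename_rename {s : SrcSort} (M : Src s) : ∀ ρ κ ρ' κ' : ℕ → ℕ,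
    (M.rename ρ κ).rename ρ' κ' = M.rename (ρ' ∘ ρ) (κ' ∘ κ) := by
  induction M <;> intro ρ κ ρ' κ' <;> simp_all [rename, lift_comp]

/-- Two composite renamings agree as soon as the underlying functions do. -/
theorem rename_comm {s : SrcSort} (M : Src s) {ρ₁ κ₁ ρ₂ κ₂ ρ₃ κ₃ ρ₄ κ₄ : ℕ → ℕ}
    (hρ : ∀ n, ρ₂ (ρ₁ n) = ρ₄ (ρ₃ n)) (hκ : ∀ n, κ₂ (κ₁ n) = κ₄ (κ₃ n)) :
    (M.rename ρ₁ κ₁).rename ρ₂ κ₂ = (M.rename ρ₃ κ₃).rename ρ₄ κ₄ := by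
  rw [rename_rename, rename_rename, show ρ₂ ∘ ρ₁ = ρ₄ ∘ ρ₃ from funext hρ,
    show κ₂ ∘ κ₁ = κ₄ ∘ κ₃ from funext hκ]

/-- A composite renaming that acts as the identity. -/
theorem rename_inv {s : SrcSort} (M : Src s) {ρ₁ κ₁ ρ₂ κ₂ : ℕ → ℕ}
    (hρ : ∀ n, ρ₂ (ρ₁ n) = n) (hκ : ∀ n, κ₂ (κ₁ n) = n) :
    (M.rename ρ₁ κ₁).rename ρ₂ κ₂ = M := by
  rw [rename_rename, show ρ₂ ∘ ρ₁ = id from funext hρ, show κ₂ ∘ κ₁ = id from funext hκ,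
    rename_id]

theorem rename_wk {s : SrcSort} (M : Src s) (ρ κ : ℕ → ℕ) :
    M.wk.rename (lift ρ) κ = (M.rename ρ κ).wk :=
  rename_comm M (fun _ => rfl) (fun _ => rfl)

theorem rename_wkC {s : SrcSort} (M : Src s) (ρ κ : ℕ → ℕ) :
    M.wkC.rename ρ (lift κ) = (M.rename ρ κ).wkC :=
  rename_comm M (fun _ => rfl) (fun _ => rfl)

theorem rename_wk₁ {s : SrcSort} (M : Src s) (ρ κ : ℕ → ℕ) :
    M.wk₁.rename (lift (lift ρ)) κ = (M.rename (lift ρ) κ).wk₁ :=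
  rename_comm M (fun n => by cases n <;> rfl) (fun _ => rfl)

theorem rename_instC {s : SrcSort} (M : Src s) (l : ℕ) (ρ κ : ℕ → ℕ) :
    (M.instC l).rename ρ κ = (M.rename ρ (lift κ)).instC (κ l) :=
  rename_comm M (fun _ => rfl) (fun n => by cases n <;> rfl)

theorem wkC_instC {s : SrcSort} (M : Src s) (l : ℕ) : M.wkC.instC l = M :=
  rename_inv M (fun _ => rfl) (fun _ => rfl)

theorem wkC_pred {s : SrcSort} (M : Src s) : M.wkC.rename id Nat.pred = M :=
  rename_inv M (fun _ => rfl) (fun _ => rfl)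

/-! ### Substitution -/

theorem liftSubst_var : liftSubst var = var := by
  funext n; cases n <;> rfl

theorem subst_var {s : SrcSort} (M : Src s) : M.subst var = M := by
  induction M <;> simp_all [subst, liftSubst_var]
  rename_i J ih
  exact ih

/-- Renaming commutes with substitution. -/
theorem subst_rename {s : SrcSort} (M : Src s) : ∀ {ρ κ ρ' : ℕ → ℕ} {σ σ' : ℕ → Src .val},
    (∀ n, σ' (ρ n) = (σ n).rename ρ' κ) →
    (M.rename ρ κ).subst σ' = (M.subst σ).rename ρ' κ := by
  have key : ∀ {ρ κ ρ' : ℕ → ℕ} {σ σ' : ℕ → Src .val},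
      (∀ n, σ' (ρ n) = (σ n).rename ρ' κ) →
      ∀ n, liftSubst σ' (lift ρ n) = (liftSubst σ n).rename (lift ρ') κ := by
    intro ρ κ ρ' σ σ' h n
    cases n with
    | zero => rfl
    | succ n => simp only [lift, liftSubst, h, rename_wk]
  induction M with
  | var x => intro _ _ _ _ _ h; exact h x
  | lam M ih => intro _ _ _ _ _ h; simp only [rename, subst, ih (key h)]
  | ofVal V ih => intro _ _ _ _ _ h; simp only [rename, subst, ih h]
  | app M N ihM ihN => intro _ _ _ _ _ h; simp only [rename, subst, ihM h, ihN h]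
  | letT L M ihL ihM => intro _ _ _ _ _ h; simp only [rename, subst, ihL (key h), ihM h]
  | mu J ih =>
    intro _ _ _ _ _ h
    simp only [rename, subst]
    rw [ih (fun n => by rw [h, rename_wkC])]
  | jmp k M ih => intro _ _ _ _ _ h; simp only [rename, subst, ih h]
  | letJ J M ihJ ihM => intro _ _ _ _ _ h; simp only [rename, subst, ihJ (key h), ihM h]

theorem rename_inst {s : SrcSort} (M : Src s) (V : Src .val) (ρ κ : ℕ → ℕ) :
    (M.inst V).rename ρ κ = (M.rename (lift ρ) κ).inst (V.rename ρ κ) :=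
  (subst_rename M (fun n => by cases n <;> rfl)).symm

theorem subst_wk₁ {s : SrcSort} (M : Src s) (σ : ℕ → Src .val) :
    M.wk₁.subst (liftSubst (liftSubst σ)) = (M.subst (liftSubst σ)).wk₁ :=
  subst_rename M (fun n => by
    cases n with
    | zero => rfl
    | succ n => exact rename_comm (σ n) (fun _ => rfl) (fun _ => rfl))

theorem subst_wkC {s : SrcSort} (M : Src s) (σ : ℕ → Src .val) :
    M.wkC.subst (fun n => (σ n).wkC) = (M.subst σ).wkC :=
  subst_rename M (fun _ => rfl)

/-- Needed for a target `η`-redex `λx.K x` whose `K` is itself an abstraction: the source then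
substitutes a variable for a variable. -/
theorem wk₁_inst_zero {s : SrcSort} (M : Src s) : M.wk₁.inst (var 0) = M := by
  have := subst_rename M (ρ := lift Nat.succ) (κ := id) (ρ' := id) (σ := var)
    (σ' := fun | 0 => var 0 | n + 1 => var n) (fun n => by cases n <;> rfl)
  rw [subst_var, rename_id] at this
  exact this

/-- Renaming commutes with the context substitution. -/
theorem rename_ctxSubst {s : SrcSort} (M : Src s) : ∀ {ρ κ : ℕ → ℕ} {k : ℕ} {L : Src .term},
    (∀ j, κ j = κ k → j = k) →
    (ctxSubst k L M).rename ρ κ = ctxSubst (κ k) (L.rename (lift ρ) κ) (M.rename ρ κ) := by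
  induction M with
  | var x => intros; rfl
  | lam M ih => intro _ _ _ _ h; simp only [rename, ctxSubst, ih h, rename_wk₁]
  | ofVal V ih => intro _ _ _ _ h; simp only [rename, ctxSubst, ih h]
  | app M N ihM ihN => intro _ _ _ _ h; simp only [rename, ctxSubst, ihM h, ihN h]
  | letT L M ihL ihM => intro _ _ _ _ h; simp only [rename, ctxSubst, ihL h, ihM h, rename_wk₁]
  | mu J ih =>
    intro _ κ k _ h
    simp only [rename, ctxSubst]
    rw [ih (fun j hj => ?_), rename_wkC]
    · rfl
    · cases j with
      | zero => simp [lift] at hj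
      | succ j => simpa [lift] using h j (by simpa [lift] using hj)
  | jmp l M ih =>
    intro _ κ k _ h
    simp only [rename, ctxSubst]
    by_cases hl : l = k
    · simp [hl, rename, ih h]
    · rw [if_neg hl, if_neg (fun e => hl (h _ e)), rename, ih h]
  | letJ J M ihJ ihM => intro _ _ _ _ h; simp only [rename, ctxSubst, ihJ h, ihM h, rename_wk₁]

theorem ctxSubst_wk₁ {s : SrcSort} (M : Src s) (k : ℕ) (L : Src .term) :
    ctxSubst k L.wk₁.wk₁ M.wk₁ = (ctxSubst k L.wk₁ M).wk₁ := by
  refine Eq.trans ?_ (rename_ctxSubst M (κ := id) (fun _ h => h)).symm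
  congr 1
  exact rename_comm L (fun n => by cases n with | zero => rfl | succ n => cases n <;> rfl)
    (fun _ => rfl)

theorem ctxSubst_wkC {s : SrcSort} (M : Src s) (k : ℕ) (L : Src .term) :
    ctxSubst (k + 1) L.wkC M.wkC = (ctxSubst k L M).wkC := by
  rw [wkC, wkC, wkC, rename_ctxSubst M (fun _ h => Nat.succ.inj h), lift_id]

/-! ### Occurrences of continuation variables -/

/-- The continuation variable `k` occurs free. -/
def OccC : {s : SrcSort} → ℕ → Src s → Prop
  | _, _, var _ => False
  | _, k, lam M => OccC k M
  | _, k, ofVal V => OccC k V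
  | _, k, app M N => OccC k M ∨ OccC k N
  | _, k, letT L M => OccC k L ∨ OccC k M
  | _, k, mu J => OccC (k + 1) J
  | _, k, jmp l M => l = k ∨ OccC k M
  | _, k, letJ J M => OccC k J ∨ OccC k M

theorem occC_rename {s : SrcSort} (M : Src s) : ∀ {ρ κ : ℕ → ℕ} {k : ℕ},
    OccC k (M.rename ρ κ) ↔ ∃ j, κ j = k ∧ OccC j M := by
  induction M with
  | var x => intros; simp [rename, OccC]
  | lam M ih => intros; simp [rename, OccC, ih]
  | ofVal V ih => intros; simp [rename, OccC, ih]
  | app M N ihM ihN => intros; simp only [rename, OccC, ihM, ihN, and_or_left, exists_or]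
  | letT M N ihM ihN => intros; simp only [rename, OccC, ihM, ihN, and_or_left, exists_or]
  | letJ M N ihM ihN => intros; simp only [rename, OccC, ihM, ihN, and_or_left, exists_or]
  | jmp l M ih =>
    intros
    simp only [rename, OccC, ih, and_or_left, exists_or]
    simp
  | mu J ih =>
    intro ρ κ k
    simp only [rename, OccC, ih]
    constructor
    · rintro ⟨j, h, hj⟩
      cases j with
      | zero => simp [lift] at h
      | succ j => exact ⟨j, by simpa [lift] using h, hj⟩
    · rintro ⟨j, h, hj⟩
      exact ⟨j + 1, by simpa [lift] using h, hj⟩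

@[simp] theorem occC_wk {s : SrcSort} (M : Src s) (k : ℕ) : OccC k M.wk ↔ OccC k M := by
  simp [wk, occC_rename]

@[simp] theorem occC_wk₁ {s : SrcSort} (M : Src s) (k : ℕ) : OccC k M.wk₁ ↔ OccC k M := by
  simp [wk₁, occC_rename]

@[simp] theorem occC_wkC {s : SrcSort} (M : Src s) (k : ℕ) :
    OccC (k + 1) M.wkC ↔ OccC k M := by
  simp [wkC, occC_rename]

@[simp] theorem not_occC_zero_wkC {s : SrcSort} (M : Src s) : ¬ OccC 0 M.wkC := by
  simp [wkC, occC_rename]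

theorem rename_congr {s : SrcSort} (M : Src s) : ∀ {ρ κ κ' : ℕ → ℕ},
    (∀ k, OccC k M → κ k = κ' k) → M.rename ρ κ = M.rename ρ κ' := by
  induction M with
  | var x => intros; rfl
  | lam M ih => intro _ _ _ h; simp only [rename]; rw [ih h]
  | ofVal V ih => intro _ _ _ h; simp only [rename]; rw [ih h]
  | app M N ihM ihN | letT M N ihM ihN | letJ M N ihM ihN =>
    intro _ _ _ h
    simp only [rename]
    rw [ihM fun k hk => h k (Or.inl hk), ihN fun k hk => h k (Or.inr hk)]
  | jmp l M ih =>
    intro _ _ _ h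
    simp only [rename]
    rw [h l (Or.inl rfl), ih fun k hk => h k (Or.inr hk)]
  | mu J ih =>
    intro _ κ κ' h
    simp only [rename]
    rw [ih (κ := lift κ) (κ' := lift κ')]
    intro k hk
    cases k with
    | zero => rfl
    | succ k => simp only [lift, h k hk]

/-- Converts the side condition `k ∉ FV(M)` into the weakened form that the axioms and `η_μ` match
on. The value `Nat.pred 0 = 0` is harmless, since index `0` does not occur. -/
theorem eq_wkC_of_not_occC {s : SrcSort} {M : Src s} (h : ¬ OccC 0 M) :
    (M.rename id Nat.pred).wkC = M := by
  rw [wkC, rename_rename]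
  conv_rhs => rw [← rename_id M]
  refine rename_congr M (fun k hk => ?_)
  cases k with
  | zero => exact absurd hk h
  | succ k => rfl

theorem occC_liftSubst {σ : ℕ → Src .val} {k n : ℕ} (h : OccC k (liftSubst σ n)) :
    ∃ m, OccC k (σ m) := by
  cases n with
  | zero => exact h.elim
  | succ n => exact ⟨n, by simpa [liftSubst] using h⟩

theorem occC_subst {s : SrcSort} (M : Src s) : ∀ {σ : ℕ → Src .val} {k : ℕ},
    OccC k (M.subst σ) → OccC k M ∨ ∃ n, OccC k (σ n) := by
  induction M with
  | var x => intro _ _ h; exact Or.inr ⟨x, h⟩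
  | lam M ih =>
    intro _ _ h
    exact (ih h).imp id fun ⟨n, hn⟩ => occC_liftSubst hn
  | ofVal V ih => intro _ _ h; exact ih h
  | app M N ihM ihN =>
    intro _ _ h
    simp only [subst, OccC] at h ⊢
    have := @ihM; have := @ihN
    grind
  | letT M N ihM ihN | letJ M N ihM ihN =>
    intro _ _ h
    rcases h with h | h
    · exact (ihM h).imp Or.inl fun ⟨n, hn⟩ => occC_liftSubst hn
    · exact (ihN h).imp Or.inr id
  | jmp l M ih =>
    intro _ _ h
    rcases h with h | h
    · exact Or.inl (Or.inl h)
    · exact (ih h).imp Or.inr id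
  | mu J ih =>
    intro _ _ h
    exact (ih h).imp id fun ⟨n, hn⟩ => ⟨n, (occC_wkC _ _).1 hn⟩

theorem occC_ctxSubst {s : SrcSort} (M : Src s) : ∀ {k j : ℕ} {L : Src .term},
    OccC j (ctxSubst k L M) → OccC j M ∨ OccC j L := by
  induction M with
  | var x => intro _ _ _ h; exact h.elim
  | lam M ih => intro _ _ _ h; exact (ih h).imp id (occC_wk₁ _ _).1
  | ofVal V ih => intro _ _ _ h; exact ih h
  | app M N ihM ihN =>
    intro _ _ _ h
    rcases h with h | h
    · exact (ihM h).imp Or.inl id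
    · exact (ihN h).imp Or.inr id
  | letT M N ihM ihN | letJ M N ihM ihN =>
    intro _ _ _ h
    rcases h with h | h
    · exact (ihM h).imp Or.inl (occC_wk₁ _ _).1
    · exact (ihN h).imp Or.inr id
  | jmp l M ih =>
    intro k _ _ h
    simp only [ctxSubst] at h
    split_ifs at h
    · rcases h with h | h | h
      · exact Or.inl (Or.inl h)
      · exact Or.inr h
      · exact (ih h).imp Or.inr id
    · rcases h with h | h
      · exact Or.inl (Or.inl h)
      · exact (ih h).imp Or.inr id
  | mu J ih =>
    intro _ _ _ h
    exact (ih h).imp id (occC_wkC _ _).1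

end Src

/-! ### Reduction on syntax trees -/

/-- A rule of `S` or an equality axiom, read in either direction. -/
def WithAxioms (S : ∀ s : SrcSort, Src s → Src s → Prop) (s : SrcSort) (A B : Src s) : Prop :=
  S s A B ∨ EqAxiom s A B ∨ EqAxiom s B A

/-- Many-step reduction by the rules of `S`, with the equality axioms as further steps. -/
def Star (S : ∀ s : SrcSort, Src s → Src s → Prop) {s : SrcSort} : Src s → Src s → Prop :=
  Relation.ReflTransGen (Compat (WithAxioms S) s)

/-- The empty set of rules. -/
def NoRule (s : SrcSort) (_ _ : Src s) : Prop := False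

theorem Compat.mono {R R' : ∀ s : SrcSort, Src s → Src s → Prop}
    (h : ∀ s A B, R s A B → R' s A B) {s : SrcSort} {A B : Src s} (hAB : Compat R s A B) :
    Compat R' s A B := by
  induction hAB with
  | root hr => exact .root (h _ _ _ hr)
  | lam _ ih => exact .lam ih
  | ofVal _ ih => exact .ofVal ih
  | appL _ ih => exact .appL ih
  | appR _ ih => exact .appR ih
  | letTL _ ih => exact .letTL ih
  | letTR _ ih => exact .letTR ih
  | mu _ ih => exact .mu ih
  | jmp _ ih => exact .jmp ih
  | letJL _ ih => exact .letJL ih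
  | letJR _ ih => exact .letJR ih

namespace Star

variable {S S' : ∀ s : SrcSort, Src s → Src s → Prop}

theorem refl {s : SrcSort} (A : Src s) : Star S A A := Relation.ReflTransGen.refl

theorem of_eq {s : SrcSort} {A B : Src s} (h : A = B) : Star S A B := h ▸ refl A

theorem trans {s : SrcSort} {A B C : Src s} (h₁ : Star S A B) (h₂ : Star S B C) : Star S A C :=
  Relation.ReflTransGen.trans h₁ h₂

theorem rule {s : SrcSort} {A B : Src s} (h : S s A B) : Star S A B :=
  Relation.ReflTransGen.single (.root (Or.inl h))

theorem ax {s : SrcSort} {A B : Src s} (h : EqAxiom s A B) : Star S A B :=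
  Relation.ReflTransGen.single (.root (Or.inr (Or.inl h)))

theorem ax_symm {s : SrcSort} {A B : Src s} (h : EqAxiom s A B) : Star S B A :=
  Relation.ReflTransGen.single (.root (Or.inr (Or.inr h)))

theorem map {s t : SrcSort} (f : Src s → Src t)
    (hf : ∀ A B, Compat (WithAxioms S) s A B → Compat (WithAxioms S') t (f A) (f B))
    {A B : Src s} (h : Star S A B) : Star S' (f A) (f B) := by
  induction h with
  | refl => exact refl _
  | tail _ h ih => exact Relation.ReflTransGen.tail ih (hf _ _ h)

theorem mono (h : ∀ s A B, S s A B → S' s A B) {s : SrcSort} {A B : Src s} (hAB : Star S A B) :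
    Star S' A B :=
  hAB.map id fun _ _ => Compat.mono fun s A B => Or.imp (h s A B) id

theorem of_noRule {s : SrcSort} {A B : Src s} (hAB : Star NoRule A B) : Star S A B :=
  hAB.mono fun _ _ _ h => h.elim

theorem of_vertical {s : SrcSort} {A B : Src s} (hAB : Star VerticalRule A B) :
    Star Rule A B :=
  hAB.mono fun _ _ _ h => by cases h with | etaMu M => exact .etaMu (.etaMu M)

theorem _root_.CCV.Compat.symm_of_noRule {s : SrcSort} {A B : Src s}
    (h : Compat (WithAxioms NoRule) s A B) : Compat (WithAxioms NoRule) s B A := by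
  induction h with
  | root hr => exact .root (hr.imp id Or.symm)
  | lam _ ih => exact .lam ih
  | ofVal _ ih => exact .ofVal ih
  | appL _ ih => exact .appL ih
  | appR _ ih => exact .appR ih
  | letTL _ ih => exact .letTL ih
  | letTR _ ih => exact .letTR ih
  | mu _ ih => exact .mu ih
  | jmp _ ih => exact .jmp ih
  | letJL _ ih => exact .letJL ih
  | letJR _ ih => exact .letJR ih

/-- Without rules only the axioms remain, and these are steps in both directions. Rearrangements of
`let`s can thus be undone inside a reduction. -/
theorem symm_of_noRule {s : SrcSort} {A B : Src s} (h : Star NoRule A B) : Star NoRule B A := by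
  induction h with
  | refl => exact refl _
  | tail _ h ih => exact (Relation.ReflTransGen.single h.symm_of_noRule).trans ih

theorem lam {M M' : Src .term} (h : Star S M M') : Star S (Src.lam M) (Src.lam M') :=
  h.map _ (fun _ _ => .lam)

theorem ofVal {V V' : Src .val} (h : Star S V V') : Star S (Src.ofVal V) (Src.ofVal V') :=
  h.map _ (fun _ _ => .ofVal)

theorem app {M M' N N' : Src .term} (h : Star S M M') (h' : Star S N N') :
    Star S (Src.app M N) (Src.app M' N') :=
  (h.map (Src.app · N) (fun _ _ => .appL)).trans
    (h'.map _ (fun _ _ => .appR))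

theorem letT {L L' M M' : Src .term} (h : Star S L L') (h' : Star S M M') :
    Star S (Src.letT L M) (Src.letT L' M') :=
  (h.map (Src.letT · M) (fun _ _ => .letTL)).trans
    (h'.map _ (fun _ _ => .letTR))

theorem mu {J J' : Src .jump} (h : Star S J J') : Star S (Src.mu J) (Src.mu J') :=
  h.map _ (fun _ _ => .mu)

theorem jmp {k : ℕ} {M M' : Src .term} (h : Star S M M') :
    Star S (Src.jmp k M) (Src.jmp k M') :=
  h.map _ (fun _ _ => .jmp)

theorem letJ {J J' : Src .jump} {M M' : Src .term} (h : Star S J J') (h' : Star S M M') :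
    Star S (Src.letJ J M) (Src.letJ J' M') :=
  (h.map (Src.letJ · M) (fun _ _ => .letJL)).trans
    (h'.map _ (fun _ _ => .letJR))

end Star

theorem Compat.of_withAxioms {S : ∀ s : SrcSort, Src s → Src s → Prop} {s : SrcSort}
    {A B : Src s} (h : Compat (WithAxioms S) s A B) :
    Compat S s A B ∨ Compat EqAxiom s A B ∨ Compat EqAxiom s B A := by
  induction h with
  | root hr => exact hr.imp .root (Or.imp .root .root)
  | lam _ ih => exact ih.imp .lam (Or.imp .lam .lam)
  | ofVal _ ih => exact ih.imp .ofVal (Or.imp .ofVal .ofVal)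
  | appL _ ih => exact ih.imp .appL (Or.imp .appL .appL)
  | appR _ ih => exact ih.imp .appR (Or.imp .appR .appR)
  | letTL _ ih => exact ih.imp .letTL (Or.imp .letTL .letTL)
  | letTR _ ih => exact ih.imp .letTR (Or.imp .letTR .letTR)
  | mu _ ih => exact ih.imp .mu (Or.imp .mu .mu)
  | jmp _ ih => exact ih.imp .jmp (Or.imp .jmp .jmp)
  | letJL _ ih => exact ih.imp .letJL (Or.imp .letJL .letJL)
  | letJR _ ih => exact ih.imp .letJR (Or.imp .letJR .letJR)

/-- In the quotient, axiom steps become equalities and only the rule steps remain. -/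
theorem Star.stepOf {S : ∀ s : SrcSort, Src s → Src s → Prop} {s : SrcSort} {A B : Src s}
    (h : Star S A B) : Relation.ReflTransGen (StepOf S) (Expr.mk A) (Expr.mk B) := by
  induction h with
  | refl => exact .refl
  | @tail B C _ h ih =>
    rcases h.of_withAxioms with h | h | h
    · exact ih.tail ⟨_, _, rfl, rfl, h⟩
    · rwa [show Expr.mk C = Expr.mk B from (Quotient.sound (Relation.EqvGen.rel _ _ h)).symm]
    · rwa [show Expr.mk C = Expr.mk B from Quotient.sound (Relation.EqvGen.rel _ _ h)]

namespace Src

/-- The continuation variable to which a jump passes its argument. -/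
def hd : Src .jump → ℕ
  | jmp k _ => k
  | letJ J _ => hd J

/-- The term that is left when the head of a jump is removed. -/
def strip : Src .jump → Src .term
  | jmp _ M => M
  | letJ J M => letT (strip J) M

theorem hd_rename (ρ κ : ℕ → ℕ) : ∀ J : Src .jump, hd (J.rename ρ κ) = κ (hd J)
  | jmp _ _ => by simp only [rename, hd]
  | letJ J _ => by simp only [rename, hd, hd_rename (lift ρ) κ J]

theorem strip_rename (ρ κ : ℕ → ℕ) : ∀ J : Src .jump, strip (J.rename ρ κ) = (strip J).rename ρ κ
  | jmp _ _ => by simp only [rename, strip]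
  | letJ J M => by simp only [rename, strip, strip_rename (lift ρ) κ J]

/-- Repeated use of `jmpLet` from right to left pushes the head outwards past all `let`s. -/
theorem jmp_hd_strip {S : ∀ s : SrcSort, Src s → Src s → Prop} :
    ∀ J : Src .jump, Star S J (jmp (hd J) (strip J))
  | jmp _ _ => by simp only [hd, strip]; exact .refl _
  | letJ J M => by
    simp only [hd, strip]
    exact ((jmp_hd_strip J).letJ (.refl M)).trans (.ax_symm (.jmpLet _ _ M))

theorem jmp_hd_strip_symm {S : ∀ s : SrcSort, Src s → Src s → Prop} (J : Src .jump) :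
    Star S (jmp (hd J) (strip J)) J :=
  .of_noRule (Star.symm_of_noRule (jmp_hd_strip J))

/-- The associativity axiom for jumps. -/
theorem letJ_assoc {S : ∀ s : SrcSort, Src s → Src s → Prop} (J : Src .jump) (M N : Src .term) :
    Star S (letJ J (letT M N)) (letJ (letJ J.wk₁ M) N) := by
  refine (jmp_hd_strip _).trans (Star.trans ?_ (jmp_hd_strip_symm _))
  simp only [hd, strip, wk₁, hd_rename, strip_rename]
  exact .jmp (.ax (.assoc _ _ _))

/-! ### The vertical normal form -/

/-- `slet` and `smu` recurse only along the chain of outer `let`s of a term, and this is the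
matching induction principle. -/
theorem spine_induction {P : Src .term → Prop} (hlet : ∀ L M, P L → P (letT L M))
    (hhead : ∀ M, (∀ L N, M ≠ letT L N) → P M) : ∀ M, P M
  | letT L M => hlet L M (spine_induction hlet hhead L)
  | ofVal V => hhead _ fun _ _ => nofun
  | app M N => hhead _ fun _ _ => nofun
  | mu J => hhead _ fun _ _ => nofun

/-- `L⟨x := M⟩`, with the outer `let`s of `M` moved outwards. -/
def slet : Src .term → Src .term → Src .term
  | L, letT M N => letT (slet L.wk₁ M) N
  | L, M => letT L M

open Classical in
/-- `μk.[l]M`, with the outer `let`s of `M` moved out of the `μ` as far as possible, and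
`η_μ`-contracted if possible. -/
noncomputable def smu : ℕ → Src .term → Src .term
  | l, letT M N =>
      if OccC 0 N then mu (jmp l (letT M N)) else letT (smu l M) (N.rename id Nat.pred)
  | l, M => if l = 0 ∧ ¬ OccC 0 M then M.rename id Nat.pred else mu (jmp l M)

/-- `μk.J` for a normal jump `J`. -/
noncomputable def smuJ : Src .jump → Src .term
  | jmp l M => smu l M
  | letJ J M => mu (letJ J M)

/-- `J⟨x := M⟩` for a normal jump `J`. -/
def sletJ : Src .jump → Src .term → Src .jump
  | jmp l L, M => jmp l (slet L M)
  | letJ J L, M => letJ (letJ J L) M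

/-- The vertical normal form of a syntax tree, in which jumps have the form `[k]M`. -/
noncomputable def nf : {s : SrcSort} → Src s → Src s
  | _, var x => var x
  | _, lam M => lam (nf M)
  | _, ofVal V => ofVal (nf V)
  | _, app M N => app (nf M) (nf N)
  | _, letT L M => slet (nf L) (nf M)
  | _, mu J => smuJ (nf J)
  | _, jmp k M => jmp k (nf M)
  | _, letJ J M => sletJ (nf J) (nf M)

/-- Consequently the `letJ` clauses of `smuJ` and `sletJ` are never reached when `nf` is computed.
-/
theorem nf_jump : ∀ J : Src .jump, ∃ l C, nf J = jmp l C
  | jmp k M => ⟨k, nf M, rfl⟩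
  | letJ J M => by
    obtain ⟨l, C, h⟩ := nf_jump J
    exact ⟨l, slet C (nf M), by rw [nf, h, sletJ]⟩

theorem slet_letT (L M N : Src .term) : slet L (letT M N) = letT (slet L.wk₁ M) N := by
  rw [slet]

theorem slet_head (L : Src .term) {M : Src .term} (h : ∀ L N, M ≠ letT L N) :
    slet L M = letT L M := by
  cases M with
  | letT L N => exact absurd rfl (h L N)
  | _ => rw [slet]; exact h

theorem smu_letT_of_occC (l : ℕ) (M : Src .term) {N : Src .term} (h : OccC 0 N) :
    smu l (letT M N) = mu (jmp l (letT M N)) := by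
  rw [smu, if_pos h]

theorem smu_letT_wkC (l : ℕ) (M N : Src .term) :
    smu l (letT M N.wkC) = letT (smu l M) N := by
  rw [smu, if_neg (not_occC_zero_wkC N), wkC_pred]

theorem smu_head (l : ℕ) {M : Src .term} (h : ∀ L N, M ≠ letT L N) (h' : l ≠ 0 ∨ OccC 0 M) :
    smu l M = mu (jmp l M) := by
  have h'' : ¬ (l = 0 ∧ ¬ OccC 0 M) := by tauto
  cases M with
  | letT L N => exact absurd rfl (h L N)
  | _ =>
    rw [smu]
    · exact if_neg h''
    · exact h

theorem smu_head_of_not_occC {M : Src .term} (h : ∀ L N, M ≠ letT L N) (h' : ¬ OccC 0 M) :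
    smu 0 M = M.rename id Nat.pred := by
  cases M with
  | letT L N => exact absurd rfl (h L N)
  | _ =>
    rw [smu]
    · exact if_pos ⟨rfl, h'⟩
    · exact h

theorem ne_letT_rename {M : Src .term} (h : ∀ L N, M ≠ letT L N) (ρ κ : ℕ → ℕ) (L N : Src .term) :
    M.rename ρ κ ≠ letT L N := by
  cases M with
  | letT L N => exact absurd rfl (h L N)
  | _ => exact nofun

/-- As the bound variable is not free in the term, all outer `let`s leave the `μ`, and what remains
is an `η_μ`-redex. This is the invariance of `nf` under `η_μ`. -/
theorem smu_zero_wkC (M : Src .term) : smu 0 M.wkC = M := by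
  induction M using spine_induction with
  | hlet L M ih =>
    rw [wkC, rename, lift_id]
    exact (smu_letT_wkC 0 _ M).trans (congrArg (letT · M) ih)
  | hhead M h =>
    rw [smu_head_of_not_occC (M := M.wkC) (ne_letT_rename h _ _) (not_occC_zero_wkC M), wkC_pred]

theorem slet_rename (M : Src .term) : ∀ (L : Src .term) (ρ κ : ℕ → ℕ),
    slet (L.rename (lift ρ) κ) (M.rename ρ κ) = (slet L M).rename ρ κ := by
  induction M using spine_induction with
  | hlet D H ih =>
    intro L ρ κ
    simp only [rename, slet_letT, ← ih, rename_wk₁]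
  | hhead M h =>
    intro L ρ κ
    rw [slet_head _ h, slet_head _ (ne_letT_rename h ρ κ), rename]

/-- The choices made by `smu` depend only on occurrences of index `0`, and `lift κ` sends `0`, and
nothing else, to `0`. -/
theorem smu_rename (M : Src .term) : ∀ (l : ℕ) (ρ κ : ℕ → ℕ),
    smu (lift κ l) (M.rename ρ (lift κ)) = (smu l M).rename ρ κ := by
  induction M using spine_induction with
  | hlet D H ih =>
    intro l ρ κ
    by_cases h : OccC 0 H
    · have h' : OccC 0 (H.rename ρ (lift κ)) := (occC_rename H).2 ⟨0, rfl, h⟩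
      rw [smu_letT_of_occC _ _ h, rename, smu_letT_of_occC _ _ h']
      rfl
    · rw [← eq_wkC_of_not_occC h, rename, rename_wkC, smu_letT_wkC, smu_letT_wkC, ih, rename]
  | hhead M h =>
    intro l ρ κ
    by_cases h' : l ≠ 0 ∨ OccC 0 M
    · rw [smu_head _ h h', smu_head _ (ne_letT_rename h _ _)]
      · rfl
      · refine h'.imp (fun h' h'' => h' (lift_eq_zero.1 h'')) fun h' => (occC_rename M).2 ⟨0, rfl, h'⟩
    · simp only [not_or, not_not] at h'
      rw [h'.1, ← eq_wkC_of_not_occC h'.2, rename_wkC, smu_zero_wkC, lift, smu_zero_wkC]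

theorem nf_rename {s : SrcSort} (M : Src s) : ∀ ρ κ : ℕ → ℕ,
    nf (M.rename ρ κ) = (nf M).rename ρ κ := by
  induction M with
  | var x => intros; rfl
  | lam M ih => intros; simp only [rename, nf, ih]
  | ofVal V ih => intros; simp only [rename, nf, ih]
  | app M N ihM ihN => intros; simp only [rename, nf, ihM, ihN]
  | letT L M ihL ihM => intros; simp only [rename, nf, ihL, ihM, slet_rename]
  | mu J ih =>
    intros
    obtain ⟨l, C, h⟩ := nf_jump J
    simp only [rename, nf, ih, h, smuJ, smu_rename]
  | jmp k M ih => intros; simp only [rename, nf, ih]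
  | letJ J M ihJ ihM =>
    intros
    obtain ⟨l, C, h⟩ := nf_jump J
    simp only [rename, nf, ihJ, ihM, h, sletJ, slet_rename]

/-- The counterpart of the axiom `assoc` for normal trees. -/
theorem slet_assoc (N : Src .term) : ∀ L M : Src .term,
    slet L (slet M N) = slet (slet L.wk₁ M) N := by
  induction N using spine_induction with
  | hlet D H ih =>
    intro L M
    rw [slet_letT, slet_letT, slet_letT, ih]
    congr 2
    refine Eq.trans ?_ (slet_rename M L.wk₁ (lift Nat.succ) id)
    congr 1
    exact (rename_wk₁ L Nat.succ id).symm
  | hhead N h => intro L M; rw [slet_head _ h, slet_head _ h, slet_letT]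

/-- The counterpart of the axiom `muLet`: no `let` of the weakened `M` mentions the variable bound
by `μ`, so all of them move out. -/
theorem slet_smu (M : Src .term) : ∀ (l : ℕ) (L : Src .term),
    slet (smu l L) M = smu l (slet L M.wkC) := by
  induction M using spine_induction with
  | hlet D H ih =>
    intro l L
    rw [slet_letT, wkC, rename, slet_letT]
    refine Eq.trans ?_ (smu_letT_wkC l _ H).symm
    have := ih l L.wk₁
    rw [lift_id]
    rw [wkC] at this
    rw [← this]
    congr 2
    have := smu_rename L l (lift Nat.succ) id
    rw [lift_id] at this
    exact this.symm
  | hhead M h =>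
    intro l L
    rw [slet_head _ h, slet_head L (M := M.wkC) (ne_letT_rename h _ _)]
    exact (smu_letT_wkC l L M).symm

/-! ### Invariance of the vertical normal form -/

theorem nf_of_eqAxiom {s : SrcSort} {A B : Src s} (h : EqAxiom s A B) : nf A = nf B := by
  cases h with
  | assoc L M N => simp only [nf, slet_assoc, wk₁, nf_rename]
  | muLet J M =>
    obtain ⟨l, C, h⟩ := nf_jump J
    simp only [nf, h, smuJ, sletJ, slet_smu, wkC, nf_rename]
  | jmpLet k L M => simp only [nf, sletJ]

theorem nf_of_verticalRule {s : SrcSort} {A B : Src s} (h : VerticalRule s A B) :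
    nf A = nf B := by
  cases h with
  | etaMu M =>
    simp only [nf, smuJ, wkC, nf_rename]
    exact smu_zero_wkC _

theorem nf_of_compat {R : ∀ s : SrcSort, Src s → Src s → Prop}
    (hR : ∀ s A B, R s A B → nf A = nf B) {s : SrcSort} {A B : Src s} (h : Compat R s A B) :
    nf A = nf B := by
  induction h with
  | root h => exact hR _ _ _ h
  | _ _ ih => simp only [nf, ih]

theorem nf_of_star {s : SrcSort} {A B : Src s} (h : Star VerticalRule A B) : nf A = nf B := by
  induction h with
  | refl => rfl
  | tail _ h ih =>
    refine ih.trans (nf_of_compat ?_ h)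
    rintro s A B (h | h | h)
    · exact nf_of_verticalRule h
    · exact nf_of_eqAxiom h
    · exact (nf_of_eqAxiom h).symm

end Src

-- Vertical reduction to the normal form, and substitution modulo normal forms

namespace Src

variable {S : ∀ s : SrcSort, Src s → Src s → Prop}

theorem star_slet (M : Src .term) : ∀ L : Src .term, Star S (letT L M) (slet L M) := by
  induction M using spine_induction with
  | hlet D H ih =>
    intro L
    rw [slet_letT]
    exact (Star.ax (.assoc L D H)).trans ((ih _).letT (.refl H))
  | hhead M h => intro L; rw [slet_head _ h]; exact .refl _

/-- Either the smart constructor only rearranges `let`s, or an `η_μ`-contraction takes place. -/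
theorem star_smu_or (M : Src .term) : ∀ l : ℕ,
    Star NoRule (mu (jmp l M)) (smu l M) ∨ l = 0 ∧ ¬ OccC 0 M := by
  induction M using spine_induction with
  | hlet D H ih =>
    intro l
    by_cases h : OccC 0 H
    · rw [smu_letT_of_occC _ _ h]
      exact Or.inl (.refl _)
    · rw [← eq_wkC_of_not_occC h, smu_letT_wkC]
      refine (ih l).imp (fun ih => ?_) fun h' => ⟨h'.1, fun e => h'.2 ?_⟩
      · exact (Star.mu (.ax (.jmpLet l D _))).trans
          ((Star.ax_symm (.muLet (jmp l D) _)).trans (ih.letT (.refl _)))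
      · exact e.resolve_right (not_occC_zero_wkC _)
  | hhead M h =>
    intro l
    by_cases h' : l ≠ 0 ∨ OccC 0 M
    · rw [smu_head _ h h']
      exact Or.inl (.refl _)
    · exact Or.inr (by simpa only [not_or, not_not] using h')

theorem star_smu (l : ℕ) (M : Src .term) : Star VerticalRule (mu (jmp l M)) (smu l M) := by
  rcases star_smu_or M l with h | ⟨rfl, h⟩
  · exact .of_noRule h
  · rw [← eq_wkC_of_not_occC h, smu_zero_wkC]
    exact .rule (.etaMu _)

theorem star_nf {s : SrcSort} (M : Src s) : Star VerticalRule M (nf M) := by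
  induction M with
  | var x => exact .refl _
  | lam M ih => exact .lam ih
  | ofVal V ih => exact .ofVal ih
  | app M N ihM ihN => exact .app ihM ihN
  | letT L M ihL ihM => exact (ihL.letT ihM).trans (star_slet _ _)
  | mu J ih =>
    obtain ⟨l, C, h⟩ := nf_jump J
    rw [nf, h, smuJ]
    rw [h] at ih
    exact ih.mu.trans (star_smu l C)
  | jmp k M ih => exact .jmp ih
  | letJ J M ihJ ihM =>
    obtain ⟨l, C, h⟩ := nf_jump J
    rw [nf, h, sletJ]
    rw [h] at ihJ
    exact (ihJ.letJ ihM).trans ((Star.ax_symm (.jmpLet _ _ _)).trans (star_slet _ _).jmp)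

theorem nf_nf {s : SrcSort} (M : Src s) : nf (nf M) = nf M := (nf_of_star (star_nf M)).symm

/-- A function that respects the equality axioms and `η_μ` up to vertical normal forms respects
equality of vertical normal forms. -/
theorem congr_of_nf_eq {s t : SrcSort} {f : Src s → Src t}
    (hf : ∀ A B, Compat (WithAxioms VerticalRule) s A B → nf (f A) = nf (f B))
    {A B : Src s} (h : nf A = nf B) : nf (f A) = nf (f B) := by
  have key : ∀ {A B}, Star VerticalRule A B → nf (f A) = nf (f B) := by
    intro A B h
    induction h with
    | refl => rfl
    | tail _ h ih => exact ih.trans (hf _ _ h)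
  rw [key (star_nf A), key (star_nf B), h]

/-- It suffices to check the rules and one direction of the axioms. -/
theorem nf_congr_of_rules {s t : SrcSort} {f : Src s → Src t} {A B : Src s}
    (hV : ∀ A B, VerticalRule s A B → nf (f A) = nf (f B))
    (hE : ∀ A B, EqAxiom s A B → nf (f A) = nf (f B))
    (h : WithAxioms VerticalRule s A B) : nf (f A) = nf (f B) := by
  rcases h with h | h | h
  · exact hV _ _ h
  · exact hE _ _ h
  · exact (hE _ _ h).symm

theorem nf_rename_congr {s : SrcSort} {A B : Src s} (h : nf A = nf B) (ρ κ : ℕ → ℕ) :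
    nf (A.rename ρ κ) = nf (B.rename ρ κ) := by
  rw [nf_rename, nf_rename, h]

/-- Substitution takes instances of the axioms and of `η_μ` to instances of the same, and `nf` is
compositional. -/
theorem nf_subst_of_compat {s : SrcSort} {A B : Src s}
    (h : Compat (WithAxioms VerticalRule) s A B) : ∀ σ : ℕ → Src .val,
    nf (A.subst σ) = nf (B.subst σ) := by
  induction h with
  | root h =>
    intro σ
    refine nf_congr_of_rules (f := fun A => A.subst σ) (fun A B h => ?_) (fun A B h => ?_) h
    · cases h with
      | etaMu M =>
        simp only [subst, subst_wkC]
        exact nf_of_verticalRule (.etaMu _)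
    · cases h with
      | assoc L M N =>
        simp only [subst, subst_wk₁]
        exact nf_of_eqAxiom (.assoc _ _ _)
      | muLet J M =>
        simp only [subst, subst_wkC]
        rw [nf_of_eqAxiom (.muLet _ _)]
        congr 4
        funext n
        cases n with
        | zero => rfl
        | succ n => exact rename_comm _ (fun _ => rfl) (fun _ => rfl)
      | jmpLet k L M => exact nf_of_eqAxiom (.jmpLet _ _ _)
  | _ _ ih => intro σ; simp only [subst, nf, ih]

theorem nf_subst_congr {s : SrcSort} {A B : Src s} (h : nf A = nf B) (σ : ℕ → Src .val) :
    nf (A.subst σ) = nf (B.subst σ) :=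
  congr_of_nf_eq (fun _ _ h => nf_subst_of_compat h σ) h

theorem nf_ctxSubst_of_compat {s : SrcSort} {A B : Src s}
    (h : Compat (WithAxioms VerticalRule) s A B) : ∀ (k : ℕ) (L : Src .term),
    nf (ctxSubst k L A) = nf (ctxSubst k L B) := by
  induction h with
  | root h =>
    intro k L
    refine nf_congr_of_rules (f := fun A => ctxSubst k L A) (fun A B h => ?_) (fun A B h => ?_) h
    · cases h with
      | etaMu M =>
        simp only [ctxSubst, ctxSubst_wkC]
        -- The head of the `η_μ`-redex is the bound variable `0`, whereas the substitution under `μ`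
        -- acts on `k + 1`.
        rw [if_neg (by omega)]
        exact nf_of_verticalRule (.etaMu _)
    · cases h with
      | assoc L M N =>
        simp only [ctxSubst, ctxSubst_wk₁]
        exact nf_of_eqAxiom (.assoc _ _ _)
      | muLet J M =>
        simp only [ctxSubst, ctxSubst_wkC]
        rw [nf_of_eqAxiom (.muLet _ _)]
        congr 4
        exact rename_comm _ (fun _ => rfl) (fun _ => rfl)
      | jmpLet l M N =>
        simp only [ctxSubst]
        split_ifs
        -- When the head is replaced, a new `let` surrounds the old one; `assoc` moves the old one
        -- out before `jmpLet` applies.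
        · exact (congrArg (jmp l) (nf_of_eqAxiom (.assoc _ _ _))).trans
            (nf_of_eqAxiom (.jmpLet l (letT L.wk₁ (ctxSubst k L.wk₁ M)) (ctxSubst k L N)))
        · exact nf_of_eqAxiom (.jmpLet _ _ _)
  | jmp _ ih => intro k L; simp only [ctxSubst]; split_ifs <;> simp only [nf, ih]
  | _ _ ih => intro k L; simp only [ctxSubst, nf, ih]

theorem nf_ctxSubst_congr {s : SrcSort} {A B : Src s} (h : nf A = nf B) (k : ℕ)
    (L : Src .term) : nf (ctxSubst k L A) = nf (ctxSubst k L B) :=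
  congr_of_nf_eq (fun _ _ h => nf_ctxSubst_of_compat h k L) h

/-! ### Vertical normal forms exist and are unique -/

/-- The number of `μ`-abstractions. -/
def muCount : {s : SrcSort} → Src s → ℕ
  | _, var _ => 0
  | _, lam M => muCount M
  | _, ofVal V => muCount V
  | _, app M N => muCount M + muCount N
  | _, letT L M => muCount L + muCount M
  | _, mu J => muCount J + 1
  | _, jmp _ M => muCount M
  | _, letJ J M => muCount J + muCount M

theorem muCount_rename {s : SrcSort} (M : Src s) : ∀ ρ κ : ℕ → ℕ,
    muCount (M.rename ρ κ) = muCount M := by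
  induction M <;> intros <;> simp_all [rename, muCount]

theorem muCount_of_compat_eqAxiom {s : SrcSort} {A B : Src s} (h : Compat EqAxiom s A B) :
    muCount A = muCount B := by
  induction h with
  | root h =>
    cases h <;> simp only [muCount, wk₁, wkC, muCount_rename] <;> omega
  | _ _ ih => simp only [muCount, ih]

theorem muCount_of_compat_vertical {s : SrcSort} {A B : Src s}
    (h : Compat VerticalRule s A B) : muCount B < muCount A := by
  induction h with
  | root h => cases h; simp only [muCount, wkC, muCount_rename]; omega
  | _ _ ih => simp only [muCount]; omega

theorem muCount_of_star {s : SrcSort} {A B : Src s} (h : Star VerticalRule A B) :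
    muCount B ≤ muCount A := by
  induction h with
  | refl => exact le_rfl
  | tail _ h ih =>
    rcases h.of_withAxioms with h | h | h
    · exact (muCount_of_compat_vertical h).le.trans ih
    · exact (muCount_of_compat_eqAxiom h).ge.trans ih
    · exact (muCount_of_compat_eqAxiom h).le.trans ih

end Src

theorem Expr.mk_eq_induction {s : SrcSort} {α : Type*} {f : Src s → α}
    (hf : ∀ A B, Compat EqAxiom s A B → f A = f B) {A B : Src s}
    (h : Expr.mk A = Expr.mk B) : f A = f B := by
  have h' : Relation.EqvGen (Compat EqAxiom s) A B := Quotient.exact h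
  clear h
  induction h' with
  | rel _ _ h => exact hf _ _ h
  | refl => rfl
  | symm _ _ _ ih => exact ih.symm
  | trans _ _ _ _ _ ih ih' => exact ih.trans ih'

theorem nf_eq_of_mk_eq {s : SrcSort} {A B : Src s} (h : Expr.mk A = Expr.mk B) :
    nf A = nf B :=
  Expr.mk_eq_induction (fun _ _ h => nf_of_compat (fun _ _ _ => nf_of_eqAxiom) h) h

theorem nf_eq_of_vertical {s : SrcSort} {A : Src s} {d : Expr s}
    (h : Relation.ReflTransGen Vertical (Expr.mk A) d) :
    ∃ D, Expr.mk D = d ∧ nf A = nf D := by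
  induction h with
  | refl => exact ⟨A, rfl, rfl⟩
  | tail _ h ih =>
    obtain ⟨D, hD, hA⟩ := ih
    obtain ⟨B, C, hB, hC, h⟩ := h
    refine ⟨C, hC, hA.trans ((nf_eq_of_mk_eq (hD.trans hB.symm)).trans ?_)⟩
    exact nf_of_compat (fun _ _ _ => nf_of_verticalRule) h

/-- A vertical step from `nf M` would lead to some `B` with fewer `μ`s. But `nf B = nf M`, and `nf
B` has at most as many `μ`s as `B`. -/
theorem isVerticalNF_nf {s : SrcSort} (M : Src s) :
    IsVerticalNF (Expr.mk M) (Expr.mk (nf M)) := by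
  refine ⟨(star_nf M).stepOf, ?_⟩
  rintro e ⟨A, B, hA, -, h⟩
  have h₁ : muCount A = muCount (nf M) :=
    Expr.mk_eq_induction (fun _ _ => muCount_of_compat_eqAxiom) hA
  have h₂ : nf B = nf M := by
    rw [← nf_nf M, ← nf_eq_of_mk_eq hA, nf_of_compat (fun _ _ _ => nf_of_verticalRule) h]
  have h₃ := muCount_of_star (star_nf B)
  have h₄ := muCount_of_compat_vertical h
  rw [h₂] at h₃
  omega

/-- A representative `D` of `d` has the same `nf` as `M` and reduces to it vertically; as `d` is
normal, this reduction is empty. -/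
theorem IsVerticalNF.eq_nf {s : SrcSort} {M : Src s} {d : Expr s}
    (h : IsVerticalNF (Expr.mk M) d) : d = Expr.mk (nf M) := by
  obtain ⟨D, rfl, hD⟩ := nf_eq_of_vertical h.1
  rw [hD]
  rcases Relation.ReflTransGen.cases_head (star_nf D).stepOf with h' | ⟨e, h', -⟩
  · exact h'
  · exact absurd h' (h.2 e)

/-! ### Renaming of reductions -/

theorem Src.IsValue.of_rename {M : Src .term} {ρ κ : ℕ → ℕ} (h : (M.rename ρ κ).IsValue) :
    M.IsValue := by
  obtain ⟨V, h⟩ := h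
  cases M with
  | ofVal V => exact ⟨V, rfl⟩
  | _ => exact nomatch h

theorem EqAxiom.rename {s : SrcSort} {A B : Src s} (h : EqAxiom s A B) (ρ κ : ℕ → ℕ) :
    EqAxiom s (A.rename ρ κ) (B.rename ρ κ) := by
  cases h with
  | assoc L M N => simp only [Src.rename, rename_wk₁]; exact .assoc _ _ _
  | muLet J M => simp only [Src.rename, rename_wkC]; exact .muLet _ _
  | jmpLet k L M => exact .jmpLet _ _ _

/-- The renaming need not be injective, so `Nat.pred` may be used to undo a weakening along a
reduction. For `β_μ` it suffices that `lift κ` identifies no variable with the bound one. -/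
theorem Rule.rename {s : SrcSort} {A B : Src s} (h : Rule s A B) (ρ κ : ℕ → ℕ) :
    Rule s (A.rename ρ κ) (B.rename ρ κ) := by
  cases h with
  | ad₁ N M h => simp only [Src.rename, rename_wk]; exact .ad₁ _ _ fun h' => h h'.of_rename
  | ad₂ V N h => simp only [Src.rename, rename_wk]; exact .ad₂ _ _ fun h' => h h'.of_rename
  | betaLam M V => exact .betaLam _ _
  | betaLet M V => rw [rename_inst]; exact .betaLet _ _
  | betaMu M J =>
    simp only [Src.rename]
    rw [rename_ctxSubst J fun j hj => lift_eq_zero.1 hj, rename_wkC]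
    exact .betaMu _ _
  | betaJmp l J => rw [rename_instC]; exact .betaJmp _ _
  | etaLam V => simp only [Src.rename, rename_wk]; exact .etaLam _
  | etaLet M => exact .etaLet _
  | etaMu h =>
    cases h with
    | etaMu M => simp only [Src.rename, rename_wkC]; exact .etaMu (.etaMu _)

theorem Compat.rename {R : ∀ s : SrcSort, Src s → Src s → Prop}
    (hR : ∀ s A B, R s A B → ∀ ρ κ, R s (A.rename ρ κ) (B.rename ρ κ)) {s : SrcSort}
    {A B : Src s} (h : Compat R s A B) :
    ∀ ρ κ : ℕ → ℕ, Compat R s (A.rename ρ κ) (B.rename ρ κ) := by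
  induction h with
  | root hr => exact fun ρ κ => .root (hR _ _ _ hr ρ κ)
  | lam _ ih => exact fun _ _ => .lam (ih _ _)
  | ofVal _ ih => exact fun _ _ => .ofVal (ih _ _)
  | appL _ ih => exact fun _ _ => .appL (ih _ _)
  | appR _ ih => exact fun _ _ => .appR (ih _ _)
  | letTL _ ih => exact fun _ _ => .letTL (ih _ _)
  | letTR _ ih => exact fun _ _ => .letTR (ih _ _)
  | mu _ ih => exact fun _ _ => .mu (ih _ _)
  | jmp _ ih => exact fun _ _ => .jmp (ih _ _)
  | letJL _ ih => exact fun _ _ => .letJL (ih _ _)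
  | letJR _ ih => exact fun _ _ => .letJR (ih _ _)

theorem Star.rename {s : SrcSort} {A B : Src s} (h : Star Rule A B) (ρ κ : ℕ → ℕ) :
    Star Rule (A.rename ρ κ) (B.rename ρ κ) :=
  h.map _ fun _ _ h => h.rename (fun _ _ _ h ρ κ =>
    h.imp (fun h => h.rename ρ κ) (Or.imp (fun h => h.rename ρ κ) fun h => h.rename ρ κ)) ρ κ

theorem Star.rename_noRule {s : SrcSort} {A B : Src s} (h : Star NoRule A B) (ρ κ : ℕ → ℕ) :
    Star NoRule (A.rename ρ κ) (B.rename ρ κ) :=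
  h.map _ fun _ _ h => h.rename (fun _ _ _ h ρ κ =>
    h.imp id (Or.imp (fun h => h.rename ρ κ) fun h => h.rename ρ κ)) ρ κ

/-! ### Reductions create no free continuation variables -/

theorem EqAxiom.occC_iff {s : SrcSort} {A B : Src s} (h : EqAxiom s A B) (k : ℕ) :
    OccC k B ↔ OccC k A := by
  cases h <;> simp only [OccC, occC_wk₁, occC_wkC, or_assoc]

theorem Rule.occC {s : SrcSort} {A B : Src s} (h : Rule s A B) {k : ℕ} (hk : OccC k B) :
    OccC k A := by
  cases h with
  | ad₁ N M _ => simp only [OccC, occC_wk] at hk ⊢; tauto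
  | ad₂ V N _ => simp only [OccC, occC_wk] at hk ⊢; tauto
  | betaLam M V => exact hk
  | betaLet M V =>
    refine (occC_subst M hk).imp id ?_
    rintro ⟨n, hn⟩
    cases n with
    | zero => exact hn
    | succ n => exact hn.elim
  | betaMu M J => exact (occC_ctxSubst J hk).symm.imp (occC_wkC _ _).1 id
  | betaJmp l J =>
    obtain ⟨j, rfl, hj⟩ := (occC_rename J).1 hk
    cases j with
    | zero => exact Or.inl rfl
    | succ j => exact Or.inr hj
  | etaLam V => exact Or.inl ((occC_wk _ _).2 hk)
  | etaLet M => exact Or.inr hk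
  | etaMu h => cases h with | etaMu M => exact Or.inr ((occC_wkC _ _).2 hk)

theorem Compat.occC {R : ∀ s : SrcSort, Src s → Src s → Prop}
    (hR : ∀ s A B, R s A B → ∀ k, OccC k B → OccC k A) {s : SrcSort} {A B : Src s}
    (h : Compat R s A B) : ∀ k, OccC k B → OccC k A := by
  induction h with
  | root hr => exact hR _ _ _ hr
  | lam _ ih | ofVal _ ih => exact ih
  | mu _ ih => exact fun k => ih (k + 1)
  | appL _ ih | letTL _ ih | letJL _ ih => exact fun k => Or.imp (ih k) id
  | appR _ ih | letTR _ ih | letJR _ ih | jmp _ ih => exact fun k => Or.imp id (ih k)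

theorem Star.occC {s : SrcSort} {A B : Src s} (h : Star Rule A B) {k : ℕ} (hk : OccC k B) :
    OccC k A := by
  induction h with
  | refl => exact hk
  | tail _ h ih =>
    refine ih (h.occC ?_ _ hk)
    rintro s A B (h | h | h) k hk
    · exact h.occC hk
    · exact (h.occC_iff k).1 hk
    · exact (h.occC_iff k).2 hk

/-! ### Reductions below a `μ` that can be contracted -/

/-- A reduction step of a jump either takes place below its head, or it is a `β`-contraction of
the head with a `μ`-abstraction. -/
theorem Compat.strip {A B : Src .jump} (h : Compat (WithAxioms Rule) .jump A B) :
    (hd B = hd A ∧ Star Rule (strip A) (strip B)) ∨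
      ∃ J : Src .jump, Star NoRule (Src.strip A) (Src.mu J) ∧ Star NoRule (J.instC (hd A)) B := by
  suffices ∀ {s : SrcSort} {A B : Src s}, Compat (WithAxioms Rule) s A B → ∀ e : s = .jump,
      (hd (e ▸ B) = hd (e ▸ A) ∧ Star Rule (Src.strip (e ▸ A)) (Src.strip (e ▸ B))) ∨
      ∃ J : Src .jump, Star NoRule (Src.strip (e ▸ A)) (Src.mu J) ∧
        Star NoRule (J.instC (hd (e ▸ A))) (e ▸ B) from this h rfl
  clear h A B
  intro s A B h
  induction h with
  | root h =>
    rintro rfl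
    rcases h with h | h | h
    · cases h with
      | betaJmp l J => exact Or.inr ⟨J, by simp only [Src.strip]; exact .refl _,
          by simp only [hd]; exact .refl _⟩
    · cases h with
      | jmpLet k L M => simp only [hd, Src.strip]; exact Or.inl ⟨trivial, .refl _⟩
    · cases h with
      | jmpLet k L M => simp only [hd, Src.strip]; exact Or.inl ⟨trivial, .refl _⟩
  | jmp h _ =>
    intro _
    simp only [hd, Src.strip]
    exact Or.inl ⟨trivial, Relation.ReflTransGen.single h⟩
  | letJR h _ =>
    intro _
    simp only [hd, Src.strip]
    exact Or.inl ⟨trivial, .letT (.refl _) (Relation.ReflTransGen.single h)⟩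
  | @letJL J J' M h ih =>
    intro _
    simp only [hd, Src.strip]
    refine (ih rfl).imp (fun ih => ⟨ih.1, ih.2.letT (.refl _)⟩) ?_
    rintro ⟨J₀, h₁, h₂⟩
    -- The `let` outside the contracted head is absorbed into the `μ`; instantiating the bound
    -- variable leaves its argument `M` unchanged.
    refine ⟨letJ J₀ M.wkC, (h₁.letT (.refl _)).trans (.ax (.muLet _ _)), ?_⟩
    refine Star.trans (.of_eq ?_) (h₂.letJ (.refl M))
    have : M.wkC.instC (hd J) = M := wkC_instC _ _
    simp only [instC, Src.rename, lift_id] at this ⊢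
    exact congrArg _ this
  | _ => exact fun e => nomatch e

/-- If `k` is not free in `M` and `[k]M` reduces to `J`, then `M` reduces to the vertical normal
form of `μk.J`. -/
theorem Star.nf_mu {M : Src .term} {J : Src .jump} (h : Star Rule (Src.jmp 0 M.wkC) J) :
    Star Rule M (nf (Src.mu J)) := by
  -- Invariant: either the head is still `k` and the rest is a `k`-free reduct of `M`, or a head
  -- contraction has occurred. From then on `M` reduces to `μk.J`, and later steps take place below
  -- this `μ`.
  have key : (∃ C : Src .term, hd J = 0 ∧ strip J = C.wkC ∧ Star Rule M C) ∨
      Star Rule M (Src.mu J) := by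
    induction h with
    | refl => exact Or.inl ⟨M, by simp only [hd], by simp only [strip], .refl M⟩
    | @tail A B _ h ih =>
      rcases ih with ⟨C, h₁, h₂, hC⟩ | ih
      · rcases h.strip with ⟨h₃, h₄⟩ | ⟨J₀, h₃, h₄⟩
        · refine Or.inl ⟨(strip B).rename id Nat.pred, h₃.trans h₁, ?_, hC.trans ?_⟩
          · refine (eq_wkC_of_not_occC fun h => ?_).symm
            have := h₄.occC h
            rw [h₂] at this
            exact not_occC_zero_wkC C this
          · have := h₄.rename id Nat.pred
            rwa [h₂, wkC_pred] at this
        · rw [h₂] at h₃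
          rw [h₁] at h₄
          refine Or.inr (hC.trans (Star.of_noRule ?_))
          have h₅ := h₃.rename_noRule id Nat.pred
          rw [wkC_pred] at h₅
          -- With `C` equal to `μj.J₀` modulo the axioms, replacing `j` by `k` below a new `μk` is
          -- just `α`-conversion. The two renamings differ only at index `1`, which stands for `k`
          -- inside `J₀` and is not free there.
          refine h₅.trans (Star.mu (Star.trans (.of_eq (rename_congr J₀ fun k hk => ?_)) h₄))
          cases k with
          | zero => rfl
          | succ k =>
            cases k with
            | zero =>
              exact absurd ((Star.of_noRule h₃).occC (k := 0) hk) (not_occC_zero_wkC C)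
            | succ k => rfl
      · exact Or.inr (ih.trans (Relation.ReflTransGen.single h.mu))
  rcases key with ⟨C, h₁, h₂, hC⟩ | h
  · refine hC.trans (Star.of_vertical ?_)
    have h₃ : nf (Src.mu J) = nf C := by
      have := nf_of_star (Star.mu (jmp_hd_strip (S := VerticalRule) J))
      rw [this, h₁, h₂]
      exact nf_of_verticalRule (.etaMu C)
    rw [h₃]
    exact star_nf C
  · exact h.trans (Star.of_vertical (star_nf _))

/-! ### Renaming and substitution of inverse images -/

/-- The action of a renaming on inverse images. -/
def InvRename (ρ κ : ℕ → ℕ) : (s : TgtSort) → InvTy s → InvTy s → Prop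
  | .T, A, B => B = Src.rename ρ κ A
  | .Q, A, B => B = Src.rename ρ κ A
  | .W, A, B => B = Src.rename ρ κ A
  | .K, F, G => ∀ M : Src .term, G (M.rename ρ κ) = (F M).rename ρ κ

theorem inv_rename {s : TgtSort} (P : Tgt s) : ∀ ρ κ : ℕ → ℕ,
    InvRename ρ κ s (inv P) (inv (P.rename ρ κ)) := by
  induction P with
  | lamC Q ih => intro ρ κ; exact congrArg Src.mu (ih ρ (lift κ))
  | appW V W ihV ihW =>
    intro ρ κ
    exact congrArg₂ (fun a b => Src.app (.ofVal a) (.ofVal b)) (ihV ρ κ) (ihW ρ κ)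
  | appK K W ihK ihW =>
    intro ρ κ
    exact (congrArg (fun a => inv (K.rename ρ κ) (Src.ofVal a)) (ihW ρ κ)).trans
      (ihK ρ κ (Src.ofVal (inv W)))
  | appT T K ihT ihK =>
    intro ρ κ
    exact (congrArg (fun a => inv (K.rename ρ κ) a) (ihT ρ κ)).trans (ihK ρ κ (inv T))
  | var x => intro ρ κ; rfl
  | lamW T ih => intro ρ κ; exact congrArg Src.lam (ih (lift ρ) κ)
  | cvar k => intro ρ κ M; rfl
  | lamK Q ih =>
    intro ρ κ M
    exact congrArg (fun a => Src.letJ a (M.rename ρ κ)) (ih (lift ρ) κ)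

/-- The inverse image of a term. -/
def invT (T : Tgt .T) : Src .term := inv T
/-- The inverse image of a jump. -/
def invQ (Q : Tgt .Q) : Src .jump := inv Q
/-- The inverse image of a value. -/
def invW (W : Tgt .W) : Src .val := inv W
/-- The inverse image of a continuation, filled with a term. -/
def invK (K : Tgt .K) (M : Src .term) : Src .jump := inv (s := .K) K M

@[simp] theorem invT_lamC (Q : Tgt .Q) : invT (.lamC Q) = .mu (invQ Q) := rfl
@[simp] theorem invT_appW (V W : Tgt .W) :
    invT (.appW V W) = .app (.ofVal (invW V)) (.ofVal (invW W)) := rfl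
@[simp] theorem invQ_appK (K : Tgt .K) (W : Tgt .W) :
    invQ (.appK K W) = invK K (.ofVal (invW W)) := rfl
@[simp] theorem invQ_appT (T : Tgt .T) (K : Tgt .K) : invQ (.appT T K) = invK K (invT T) := rfl
@[simp] theorem invW_var (x : ℕ) : invW (.var x) = .var x := rfl
@[simp] theorem invW_lamW (T : Tgt .T) : invW (.lamW T) = .lam (invT T) := rfl
@[simp] theorem invK_cvar (k : ℕ) (M : Src .term) : invK (.cvar k) M = .jmp k M := rfl
@[simp] theorem invK_lamK (Q : Tgt .Q) (M : Src .term) :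
    invK (.lamK Q) M = .letJ (invQ Q) M := rfl

theorem invT_rename (T : Tgt .T) (ρ κ : ℕ → ℕ) : invT (T.rename ρ κ) = (invT T).rename ρ κ :=
  inv_rename T ρ κ
theorem invQ_rename (Q : Tgt .Q) (ρ κ : ℕ → ℕ) : invQ (Q.rename ρ κ) = (invQ Q).rename ρ κ :=
  inv_rename Q ρ κ
theorem invW_rename (W : Tgt .W) (ρ κ : ℕ → ℕ) : invW (W.rename ρ κ) = (invW W).rename ρ κ :=
  inv_rename W ρ κ
/-- The action of a substitution of values on inverse images. -/
def InvSubst (σ : ℕ → Src .val) : (s : TgtSort) → Tgt s → Tgt s → Prop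
  | .T, A, B => invT B = (invT A).subst σ
  | .Q, A, B => invQ B = (invQ A).subst σ
  | .W, A, B => invW B = (invW A).subst σ
  | .K, A, B => ∀ M : Src .term, invK B (M.subst σ) = (invK A M).subst σ

theorem inv_liftW (σ : ℕ → Tgt .W) :
    (fun n => invW (Tgt.liftW σ n)) = liftSubst fun n => invW (σ n) := by
  funext n
  cases n with
  | zero => rfl
  | succ n => exact invW_rename _ _ _

/-- Holds exactly, without normal forms, because target values become source values. For a
continuation the content of the hole is substituted as well. -/
theorem inv_substW {s : TgtSort} (P : Tgt s) : ∀ σ : ℕ → Tgt .W,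
    InvSubst (fun n => invW (σ n)) s P (P.subst σ Tgt.cvar) := by
  have hK : Tgt.liftK Tgt.cvar = Tgt.cvar := by funext n; cases n <;> rfl
  induction P with
  | lamC Q ih =>
    intro σ
    have := ih fun n => (σ n).wkC
    simp only [InvSubst, Tgt.subst, hK, invT_lamC, Src.subst] at this ⊢
    rw [this]
    congr 2
    funext n
    exact invW_rename _ _ _
  | appW V W ihV ihW =>
    intro σ
    simp only [InvSubst] at ihV ihW
    simp only [InvSubst, Tgt.subst, invT_appW, ihV, ihW, Src.subst]
  | appK K W ihK ihW =>
    intro σ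
    simp only [InvSubst] at ihK ihW
    simp only [InvSubst, Tgt.subst, invQ_appK, ihW, ← ihK, Src.subst]
  | appT T K ihT ihK =>
    intro σ
    simp only [InvSubst] at ihT ihK
    simp only [InvSubst, Tgt.subst, invQ_appT, ihT, ← ihK]
  | var x => intro σ; rfl
  | lamW T ih =>
    intro σ
    have := ih (Tgt.liftW σ)
    simp only [InvSubst, inv_liftW] at this
    exact congrArg Src.lam this
  | cvar k => intro σ M; rfl
  | lamK Q ih =>
    intro σ M
    have := ih (Tgt.liftW σ)
    simp only [InvSubst, inv_liftW] at this
    exact congrArg (Src.letJ · _) this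

theorem inv_instW_subst (W : Tgt .W) :
    (fun n => invW ((fun | 0 => W | n + 1 => Tgt.var n : ℕ → Tgt .W) n)) =
      (fun | 0 => invW W | n + 1 => Src.var n) := by
  funext n; cases n <;> rfl

theorem invT_instW (T : Tgt .T) (W : Tgt .W) : invT (T.instW W) = (invT T).inst (invW W) := by
  have := inv_substW T (fun | 0 => W | n + 1 => Tgt.var n)
  rw [inv_instW_subst] at this
  exact this

theorem invQ_instW (Q : Tgt .Q) (W : Tgt .W) : invQ (Q.instW W) = (invQ Q).inst (invW W) := by
  have := inv_substW Q (fun | 0 => W | n + 1 => Tgt.var n)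
  rw [inv_instW_subst] at this
  exact this

/-- The relation between an inverse image and that of its substitution instance, in which
`[k]□` has become `[κ k]L⟨x := □⟩`. -/
def InvStruct (k : ℕ) (L : Src .term) (κ : ℕ → ℕ) : (s : TgtSort) → Tgt s → Tgt s → Prop
  | .T, A, B => nf (invT B) = nf ((ctxSubst k L (invT A)).rename id κ)
  | .Q, A, B => nf (invQ B) = nf ((ctxSubst k L (invQ A)).rename id κ)
  | .W, A, B => nf (invW B) = nf ((ctxSubst k L (invW A)).rename id κ)
  | .K, A, B => ∀ M M' : Src .term, nf M' = nf ((ctxSubst k L M).rename id κ) →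
      nf (invK B M') = nf ((ctxSubst k L (invK A M)).rename id κ)

/-- The substitution `τ` replaces `k` by a continuation `λx.Q` whose inverse image is
`[κ k]L⟨x := □⟩`, and acts as the renaming `κ` otherwise. -/
def IsStruct (k : ℕ) (L : Src .term) (κ : ℕ → ℕ) (τ : ℕ → Tgt .K) : Prop :=
  (∀ j, j ≠ k → τ j = .cvar (κ j)) ∧
    ∃ Q, τ k = .lamK Q ∧ nf (invQ Q) = nf (Src.jmp (κ k) (L.rename id κ))

theorem IsStruct.wk {k : ℕ} {L : Src .term} {κ : ℕ → ℕ} {τ : ℕ → Tgt .K}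
    (h : IsStruct k L κ τ) : IsStruct k L.wk₁ κ fun n => (τ n).wk := by
  obtain ⟨h, Q, hQ, hL⟩ := h
  refine ⟨fun j hj => congrArg Tgt.wk (h j hj), _, congrArg Tgt.wk hQ, ?_⟩
  rw [invQ_rename, nf_rename_congr hL]
  exact congrArg (fun a => nf (Src.jmp (κ k) a))
    (rename_comm L (fun _ => rfl) (fun _ => rfl))

theorem IsStruct.wkC {k : ℕ} {L : Src .term} {κ : ℕ → ℕ} {τ : ℕ → Tgt .K}
    (h : IsStruct k L κ τ) : IsStruct (k + 1) L.wkC (lift κ) (Tgt.liftK τ) := by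
  obtain ⟨h, Q, hQ, hL⟩ := h
  refine ⟨fun j hj => ?_, _, by rw [Tgt.liftK, hQ]; rfl, ?_⟩
  · cases j with
    | zero => rfl
    | succ j => rw [Tgt.liftK, h j fun e => hj (by rw [e])]; rfl
  · rw [invQ_rename, lift_id, nf_rename_congr hL]
    exact congrArg (fun a => nf (Src.jmp (κ k + 1) a))
      (rename_comm L (fun _ => rfl) (fun _ => rfl))

/-- Only the occurrences of `k` itself go beyond congruence: the target yields `Q⁻¹⟨x := □⟩`, the
source `[κ k]L⟨x := □⟩`, and these agree by `jmpLet`. Hence the comparison through `nf`. -/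
theorem inv_substK {s : TgtSort} (P : Tgt s) : ∀ {k : ℕ} {L : Src .term} {κ : ℕ → ℕ}
    {τ : ℕ → Tgt .K}, IsStruct k L κ τ → InvStruct k L κ s P (P.subst Tgt.var τ) := by
  have hW : Tgt.liftW Tgt.var = Tgt.var := by funext n; cases n <;> rfl
  induction P with
  | lamC Q ih =>
    intro k L κ τ h
    have := ih h.wkC
    simp only [InvStruct] at this
    exact congrArg smuJ this
  | appW V W ihV ihW =>
    intro k L κ τ h
    exact congrArg₂ (fun a b => Src.app (.ofVal a) (.ofVal b)) (ihV h) (ihW h)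
  | appK K W ihK ihW =>
    intro k L κ τ h
    exact ihK h (.ofVal (invW W)) _ (congrArg Src.ofVal (ihW h))
  | appT T K ihT ihK =>
    intro k L κ τ h
    exact ihK h (invT T) _ (ihT h)
  | var x => intro k L κ τ h; rfl
  | lamW T ih =>
    intro k L κ τ h
    have := ih h.wk
    simp only [InvStruct] at this
    simp only [InvStruct, Tgt.subst, hW, invW_lamW, nf, this, ctxSubst, Src.rename, lift_id]
  | cvar j =>
    intro k L κ τ h M M' hM
    obtain ⟨h, Q, hQ, hL⟩ := h
    by_cases hj : j = k
    · subst hj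
      simp only [Tgt.subst, hQ, invK_lamK, invK_cvar, ctxSubst, if_pos, Src.rename, nf, hL, hM,
        lift_id, sletJ]
    · simp only [Tgt.subst, h j hj, invK_cvar, ctxSubst, if_neg hj, Src.rename, nf, hM]
  | lamK Q ih =>
    intro k L κ τ h M M' hM
    have := ih h.wk
    simp only [InvStruct] at this
    simp only [Tgt.subst, hW, invK_lamK, nf, this, ctxSubst, Src.rename, lift_id, hM]

/-- The right-hand side is what `β_μ` followed by `β_jmp` makes of `[m]L⟨x := μk.Q⁻¹⟩`: the context
substitution keeps the name `k`, and the renaming then replaces it by `m`. -/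
theorem nf_invQ_instK_lamK (Q Q' : Tgt .Q) {m : ℕ} {L : Src .term}
    (h : nf (invQ Q') = nf (Src.jmp m L)) :
    nf (invQ (Q.instK (.lamK Q'))) = nf ((ctxSubst 0 L.wkC (invQ Q)).instC m) := by
  refine inv_substK Q (k := 0) (L := L.wkC) (κ := fun | 0 => m | n + 1 => n)
    ⟨fun j hj => ?_, Q', rfl, h.trans ?_⟩
  · cases j with
    | zero => exact absurd rfl hj
    | succ j => rfl
  · exact congrArg (fun a => nf (Src.jmp m a)) (wkC_instC L m).symm

/-- A substitution of continuation variables for continuation variables is a renaming. -/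
theorem subst_eq_rename {s : TgtSort} (P : Tgt s) : ∀ κ : ℕ → ℕ,
    P.subst Tgt.var (fun n => Tgt.cvar (κ n)) = P.rename id κ := by
  have hW : Tgt.liftW Tgt.var = Tgt.var := by funext n; cases n <;> rfl
  have hK : ∀ κ : ℕ → ℕ, Tgt.liftK (fun n => Tgt.cvar (κ n)) = fun n => Tgt.cvar (lift κ n) := by
    intro κ; funext n; cases n <;> rfl
  induction P with
  | lamC Q ih =>
    intro κ
    have : (fun n => (Tgt.var n).wkC) = Tgt.var := rfl
    simp only [Tgt.subst, Tgt.rename, hK, this, ih]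
  | lamW T ih | lamK T ih =>
    intro κ
    have : (fun n => (Tgt.cvar (κ n)).wk) = fun n => Tgt.cvar (κ n) := rfl
    simp only [Tgt.subst, Tgt.rename, hW, this, ih, lift_id]
  | var x | cvar x => intro κ; rfl
  | _ _ _ ih ih' => intro κ; simp only [Tgt.subst, Tgt.rename, ih, ih']

theorem invQ_instK_cvar (Q : Tgt .Q) (l : ℕ) :
    invQ (Q.instK (.cvar l)) = (invQ Q).instC l := by
  refine Eq.trans ?_ (invQ_rename Q id (fun | 0 => l | n + 1 => n))
  rw [← subst_eq_rename, Tgt.instK]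
  congr 2
  funext n
  cases n <;> rfl

/-! ### Terms reduce to the inverse images of their translations -/

/-- A jump `K⁻¹[M]` in which the continuation is in vertical normal form. -/
noncomputable def nfK : Tgt .K → Src .term → Src .jump
  | .cvar k, M => .jmp k M
  | .lamK Q, M => .letJ (nf (invQ Q)) M

theorem nfK_cvar (k : ℕ) (M : Src .term) : nfK (.cvar k) M = .jmp k M := by rw [nfK]

theorem nfK_lamK (Q : Tgt .Q) (M : Src .term) : nfK (.lamK Q) M = .letJ (nf (invQ Q)) M := by
  rw [nfK]

theorem Star.nfK (K : Tgt .K) {M M' : Src .term} (h : Star Rule M M') :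
    Star Rule (nfK K M) (nfK K M') := by
  cases K with
  | cvar k => simp only [nfK_cvar]; exact h.jmp
  | lamK Q => simp only [nfK_lamK]; exact .letJ (.refl _) h

theorem star_nfK_nf (K : Tgt .K) (M : Src .term) :
    Star Rule (nfK K (nf M)) (nf (invK K M)) := by
  cases K with
  | cvar k => simp only [nfK_cvar]; exact .refl _
  | lamK Q =>
    have := star_nf (nfK (.lamK Q) (nf M))
    simp only [nfK_lamK, nf, nf_nf] at this ⊢
    exact .of_vertical this

/-- `K⁻¹[L⟨x := M⟩] = K⁻¹[L]⟨x := M⟩`. -/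
theorem nfK_letT (K : Tgt .K) (L M : Src .term) :
    Star Rule (nfK K (.letT L M)) (.letJ (nfK K.wk L) M) := by
  cases K with
  | cvar k => simp only [Tgt.wk, Tgt.rename, nfK_cvar]; exact .ax (.jmpLet _ _ _)
  | lamK Q =>
    simp only [Tgt.wk, Tgt.rename, nfK_lamK, invQ_rename, nf_rename]
    exact letJ_assoc _ _ _

theorem star_mu_nf (J : Src .jump) : Star Rule (Src.mu (nf J)) (nf (Src.mu J)) := by
  have := Star.of_vertical (star_nf (Src.mu (nf J)))
  rwa [nf, nf_nf, ← nf] at this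

theorem colon_app_val_nonval (V : Src .val) {N : Src .term} (h : ¬ N.IsValue) (K : Tgt .K) :
    colon (.app (.ofVal V) N) K =
      colon N (.lamK (.appT (.appW (star V).wk (.var 0)) K.wk)) := by
  cases N with
  | ofVal V => exact absurd ⟨V, rfl⟩ h
  | _ => rw [colon]; exact fun _ => nofun

theorem colon_app_nonval_val {N : Src .term} (h : ¬ N.IsValue) (V : Src .val) (K : Tgt .K) :
    colon (.app N (.ofVal V)) K =
      colon N (.lamK (.appT (.appW (.var 0) (star V).wk) K.wk)) := by
  cases N with
  | ofVal V => exact absurd ⟨V, rfl⟩ h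
  | _ => rw [colon]; exact fun _ => nofun

theorem colon_app_nonval_nonval {N₁ N₂ : Src .term} (h₁ : ¬ N₁.IsValue) (h₂ : ¬ N₂.IsValue)
    (K : Tgt .K) : colon (.app N₁ N₂) K =
      colon N₁ (.lamK (colon N₂.wk (.lamK (.appT (.appW (.var 1) (.var 0)) K.wk.wk)))) := by
  cases N₁ with
  | ofVal V => exact absurd ⟨V, rfl⟩ h₁
  | _ =>
    cases N₂ with
    | ofVal V => exact absurd ⟨V, rfl⟩ h₂
    | _ => rw [colon] <;> exact fun _ => nofun

/-- A `let` below a continuation is reduced by reducing its body first. -/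
theorem star_nfK_lamK {Q : Tgt .Q} {K : Tgt .K} {L M : Src .term} {J : Src .jump}
    (hL : Star Rule (nfK K.wk L) (nf (invQ Q))) (hM : Star Rule (nfK (.lamK Q) M) J) :
    Star Rule (nfK K (.letT L M)) J := by
  rw [nfK_lamK] at hM
  exact (nfK_letT K L M).trans ((hL.letJ (.refl M)).trans hM)

/-- Reduction of an application of values, below a continuation. -/
theorem star_nfK_appW {K : Tgt .K} {V W : Src .val} {V' W' : Tgt .W}
    (hV : Star Rule V (nf (invW V'))) (hW : Star Rule W (nf (invW W'))) :
    Star Rule (nfK K (.app (.ofVal V) (.ofVal W))) (nf (invQ (.appT (.appW V' W') K))) :=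
  (Star.nfK K (.app hV.ofVal hW.ofVal)).trans (star_nfK_nf K (invT (.appW V' W')))

theorem star_wk {V : Src .val} {V' : Tgt .W} (h : Star Rule V (nf (invW V'))) :
    Star Rule V.wk (nf (invW V'.wk)) := by
  rw [Tgt.wk, invW_rename, nf_rename]
  exact h.rename _ _

theorem Src.IsValue.of_wk {M : Src .term} (h : M.wk.IsValue) : M.IsValue := h.of_rename

mutual

theorem star_nf_star : ∀ V : Src .val, Star Rule V (nf (invW (star V)))
  | .var x => by rw [star]; exact .refl _
  | .lam M => by
    have := star_colon M.wkC (.cvar 0)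
    rw [nfK_cvar] at this
    rw [star]
    -- The inverse image has an extra `μk` below `λx`, which `Star.nf_mu` accounts for.
    exact (Star.nf_mu this).lam.trans (.of_eq (by simp only [invW_lamW, invT_lamC, nf, nf_nf]))
termination_by V => V.size
decreasing_by simp only [Src.size, Src.size_wkC]; omega

/-- The clauses of the translation follow the source rules: values are left in place, non-values in
an application are named by `ad₁` and `ad₂`, and a `let` moves out of the continuation. Keeping the
continuation normal on the left makes the induction hypotheses compose. -/
theorem star_colon : ∀ (M : Src .term) (K : Tgt .K),
    Star Rule (nfK K M) (nf (invQ (colon M K)))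
  | .ofVal V, K => by
    rw [colon]
    exact (Star.nfK K (star_nf_star V).ofVal).trans (star_nfK_nf K (.ofVal (invW (star V))))
  | .app N₁ N₂, K => by
    by_cases h₁ : N₁.IsValue
    · obtain ⟨V, hV⟩ := h₁
      have : V.size < N₁.size := by rw [hV, Src.size]; omega
      have ihV := star_nf_star V
      subst hV
      by_cases h₂ : N₂.IsValue
      · obtain ⟨W, hW⟩ := h₂
        have : W.size < N₂.size := by rw [hW, Src.size]; omega
        have ihW := star_nf_star W
        subst hW
        rw [colon]
        exact star_nfK_appW ihV ihW
      · rw [colon_app_val_nonval V h₂]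
        exact (Star.nfK K (.rule (.ad₂ V N₂ h₂))).trans
          (star_nfK_lamK (star_nfK_appW (star_wk ihV) (.refl _)) (star_colon N₂ _))
    · by_cases h₂ : N₂.IsValue
      · obtain ⟨V, hV⟩ := h₂
        have : V.size < N₂.size := by rw [hV, Src.size]; omega
        have ihV := star_nf_star V
        subst hV
        rw [colon_app_nonval_val h₁ V]
        exact (Star.nfK K (.rule (.ad₁ N₁ _ h₁))).trans
          (star_nfK_lamK (star_nfK_appW (.refl _) (star_wk ihV)) (star_colon N₁ _))
      · rw [colon_app_nonval_nonval h₁ h₂]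
        refine (Star.nfK K (.rule (.ad₁ N₁ _ h₁))).trans (star_nfK_lamK ?_ (star_colon N₁ _))
        -- Once `ad₁` has named `N₁`, the function part is a variable, hence a value, so `ad₂` can
        -- name `N₂`.
        exact (Star.nfK _ (.rule (.ad₂ (.var 0) N₂.wk fun h => h₂ h.of_wk))).trans
          (star_nfK_lamK (star_nfK_appW (.refl _) (.refl _)) (star_colon N₂.wk _))
  | .letT L M, K => by
    rw [colon]
    exact star_nfK_lamK (star_colon L K.wk) (star_colon M _)
  | .mu J, K => by
    rw [colon]
    exact (Star.nfK K ((star_colonJ J).mu.trans (star_mu_nf _))).trans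
      (star_nfK_nf K (.mu (invQ (colonJ J))))
termination_by M => M.size
decreasing_by all_goals (simp only [Src.size, Src.size_wk]; omega)

theorem star_colonJ : ∀ J : Src .jump, Star Rule J (nf (invQ (colonJ J)))
  | .jmp k M => by
    have := star_colon M (.cvar k)
    rw [nfK_cvar] at this
    rw [colonJ]
    exact this
  | .letJ J M => by
    have := star_colon M (.lamK (colonJ J))
    rw [nfK_lamK] at this
    rw [colonJ]
    exact ((star_colonJ J).letJ (.refl M)).trans this
termination_by J => J.size
decreasing_by all_goals (simp only [Src.size]; omega)

end

/-! ### Reductions of the target calculus -/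

theorem Src.ctxSubst_of_not_occC {s : SrcSort} (M : Src s) : ∀ {k : ℕ} {L : Src .term},
    ¬ OccC k M → ctxSubst k L M = M := by
  induction M with
  | var x => intros; rfl
  | lam M ih | ofVal M ih | mu M ih => intro _ _ h; rw [ctxSubst, ih h]
  | app M N ihM ihN | letT M N ihM ihN | letJ M N ihM ihN =>
    intro _ _ h
    rw [ctxSubst, ihM fun h' => h (Or.inl h'), ihN fun h' => h (Or.inr h')]
  | jmp l M ih =>
    intro _ _ h
    rw [ctxSubst, if_neg fun h' => h (Or.inl h'), ih fun h' => h (Or.inr h')]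

theorem Src.nf_subst_congr_right {s : SrcSort} (M : Src s) : ∀ {σ σ' : ℕ → Src .val},
    (∀ n, nf (σ n) = nf (σ' n)) → nf (M.subst σ) = nf (M.subst σ') := by
  have key : ∀ {σ σ' : ℕ → Src .val}, (∀ n, nf (σ n) = nf (σ' n)) →
      ∀ n, nf (liftSubst σ n) = nf (liftSubst σ' n) := by
    intro σ σ' h n
    cases n with
    | zero => rfl
    | succ n => exact nf_rename_congr (h n) _ _
  induction M with
  | var x => intro _ _ h; exact h x
  | lam M ih => intro _ _ h; simp only [subst, nf, ih (key h)]
  | ofVal V ih => intro _ _ h; simp only [subst, nf, ih h]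
  | app M N ihM ihN => intro _ _ h; simp only [subst, nf, ihM h, ihN h]
  | letT M N ihM ihN | letJ M N ihM ihN =>
    intro _ _ h; simp only [subst, nf, ihM (key h), ihN h]
  | mu J ih =>
    intro _ _ h
    simp only [subst, nf]
    exact congrArg smuJ (ih fun n => nf_rename_congr (h n) _ _)
  | jmp k M ih => intro _ _ h; simp only [subst, nf, ih h]

theorem Src.nf_inst_nf {s : SrcSort} (M : Src s) (V : Src .val) :
    nf ((nf M).inst (nf V)) = nf (M.inst V) := by
  refine (nf_subst_congr (nf_nf M) _).trans (nf_subst_congr_right M fun n => ?_)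
  cases n with
  | zero => exact nf_nf V
  | succ n => rfl

/-- The normal form of a jump `J⟨x := M⟩` only rearranges `let`s. -/
theorem star_nf_letJ {S : ∀ s : SrcSort, Src s → Src s → Prop} (J : Src .jump) (M : Src .term) :
    Star S (nf (letJ J M)) (letJ (nf J) (nf M)) := by
  obtain ⟨l, C, h⟩ := nf_jump J
  rw [nf, h, sletJ]
  exact (Star.of_noRule (Star.symm_of_noRule (star_slet (nf M) C).jmp)).trans
    (.ax (.jmpLet l C (nf M)))

theorem star_letJ_nf (J : Src .jump) (M : Src .term) :
    Star Rule (letJ (nf J) (nf M)) (nf (letJ J M)) :=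
  Star.of_noRule (Star.symm_of_noRule (star_nf_letJ J M))

theorem Star.nf_letJ {J J' : Src .jump} {M M' : Src .term} (h : Star Rule (nf J) (nf J'))
    (h' : Star Rule (nf M) (nf M')) : Star Rule (nf (Src.letJ J M)) (nf (Src.letJ J' M')) :=
  (star_nf_letJ J M).trans ((h.letJ h').trans (star_letJ_nf J' M'))

/-- The normal form of `μk.J` either only rearranges `let`s, or contracts an `η_μ`-redex. -/
theorem star_nf_mu_or (J : Src .jump) : Star Rule (nf (mu J)) (mu (nf J)) ∨
    ∃ C : Src .term, nf J = jmp 0 C.wkC ∧ nf (mu J) = C := by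
  obtain ⟨l, C, h⟩ := nf_jump J
  rw [nf, h, smuJ]
  refine (star_smu_or C l).imp (fun h => .of_noRule (.symm_of_noRule h)) ?_
  rintro ⟨rfl, hC⟩
  refine ⟨C.rename id Nat.pred, by rw [eq_wkC_of_not_occC hC], ?_⟩
  conv_lhs => rw [← eq_wkC_of_not_occC hC]
  exact smu_zero_wkC _

/-- If `nf` has contracted the `μ` on the left, there is no `μ` left to reduce under, and
`Star.nf_mu` takes over. -/
theorem Star.nf_mu_congr {J J' : Src .jump} (h : Star Rule (nf J) (nf J')) :
    Star Rule (nf (Src.mu J)) (nf (Src.mu J')) := by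
  rcases star_nf_mu_or J with h' | ⟨C, h₁, h₂⟩
  · exact h'.trans (h.mu.trans (star_mu_nf J'))
  · rw [h₁] at h
    rw [h₂]
    have := h.nf_mu
    rwa [nf, nf_nf, ← nf] at this

theorem Star.invK {M M' : Src .term} (h : Star Rule (nf M) (nf M')) (K : Tgt .K) :
    Star Rule (nf (invK K M)) (nf (invK K M')) := by
  cases K with
  | cvar k => exact h.jmp
  | lamK Q => exact .nf_letJ (.refl _) h

theorem star_nf_letJ_ofVal (J : Src .jump) (V : Src .val) :
    Star Rule (nf (letJ J (ofVal V))) (nf (J.inst V)) := by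
  refine (star_nf_letJ J (ofVal V)).trans ?_
  rw [← nf_inst_nf]
  refine Star.trans ?_ (.of_vertical (star_nf _))
  obtain ⟨l, C, h⟩ := nf_jump J
  rw [h, nf]
  exact (Star.ax_symm (.jmpLet _ _ _)).trans (Star.rule (.betaLet _ _)).jmp

/-- If the `μ` survives in the normal form, the step is `β_jmp` for a variable `K`, and `β_μ`
followed by `β_jmp` for an abstraction. If it was an `η_μ`-redex, both sides already have the same
normal form. -/
theorem star_nf_betaC (Q : Tgt .Q) (K : Tgt .K) :
    Star Rule (nf (invK K (mu (invQ Q)))) (nf (invQ (Q.instK K))) := by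
  cases K with
  | cvar m =>
    rw [invQ_instK_cvar, invK_cvar]
    rcases star_nf_mu_or (invQ Q) with h | ⟨C, h₁, h₂⟩
    · refine h.jmp.trans ((Star.rule (.betaJmp _ _)).trans (.of_eq ?_))
      exact (nf_rename _ _ _).symm
    · refine .of_eq ?_
      rw [nf, h₂, instC, nf_rename, h₁]
      exact congrArg (jmp m) (wkC_instC C m).symm
  | lamK Q' =>
    obtain ⟨m, L, h⟩ := nf_jump (invQ Q')
    have hL : nf (invQ Q') = nf (jmp m L) := by rw [← h, nf_nf]
    have hQ : nf (invQ (Q.instK (.lamK Q'))) =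
        nf ((ctxSubst 0 L.wkC (nf (invQ Q))).instC m) :=
      (nf_invQ_instK_lamK Q Q' hL).trans
        (nf_rename_congr (nf_ctxSubst_congr (nf_nf _).symm _ _) _ _)
    rw [hQ, invK_lamK]
    rcases star_nf_mu_or (invQ Q) with h' | ⟨C, h₁, h₂⟩
    · refine (star_nf_letJ _ _).trans ?_
      rw [h]
      exact ((Star.refl _).letJ h').trans ((Star.ax_symm (.jmpLet _ _ _)).trans
        ((Star.rule (.betaMu _ _)).jmp.trans ((Star.rule (.betaJmp _ _)).trans
          (.of_vertical (star_nf _)))))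
    · refine .of_eq ?_
      have hC : nf C = C := by rw [← h₂, nf_nf]
      -- The head is the only occurrence of `k`, so the context substitution inserts exactly one
      -- `let`.
      rw [h₁, ctxSubst, if_pos rfl, ctxSubst_of_not_occC _ (not_occC_zero_wkC C), nf, h₂, hL,
        ← hC, ← nf, hC, ← nf_of_eqAxiom (.jmpLet m L C)]
      refine congrArg (fun M => nf (jmp m M)) ?_
      refine congrArg₂ letT ?_ (wkC_instC C m).symm
      rw [lift_id]
      exact (wkC_instC L m).symm

/-- Reduction between the vertical normal forms of inverse images. -/
def InvRed : {s : TgtSort} → Tgt s → Tgt s → Prop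
  | .T, A, B => Star Rule (nf (invT A)) (nf (invT B))
  | .Q, A, B => Star Rule (nf (invQ A)) (nf (invQ B))
  | .W, A, B => Star Rule (nf (invW A)) (nf (invW B))
  | .K, A, B => ∀ M : Src .term, Star Rule (nf (invK A M)) (nf (invK B M))

/-- Each target contraction is matched by source rules on normal forms; `η` on `λk` becomes an
equality, being vertical. -/
theorem invRed_of_betaEta {s : TgtSort} {A B : Tgt s} (h : BetaEta A B) : InvRed A B := by
  induction h with
  | betaC Q K => exact star_nf_betaC Q K
  | betaW T W =>
    simp only [InvRed]
    rw [invT_instW, ← nf_inst_nf]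
    exact (Star.rule (.betaLam _ _)).trans ((Star.rule (.betaLet _ _)).trans
      (.of_vertical (star_nf _)))
  | betaK Q W =>
    simp only [InvRed]
    rw [invQ_instW]
    exact star_nf_letJ_ofVal _ _
  | etaC T =>
    simp only [InvRed, invT_lamC, invQ_appT, invK_cvar, Tgt.wkC, invT_rename]
    exact .of_eq (nf_of_verticalRule (.etaMu _))
  | etaW W =>
    simp only [InvRed, invW_lamW, invT_appW, invW_var, Tgt.wk, invW_rename, nf, nf_rename]
    exact .rule (.etaLam _)
  | etaK K =>
    intro M
    cases K with
    | cvar k =>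
      -- Here `([k]x)⟨x := M⟩ = [k](x⟨x := M⟩)`, an `η_let`-redex.
      exact (star_nf_letJ _ _).trans ((Star.ax_symm (.jmpLet _ _ _)).trans
        (Star.rule (.etaLet _)).jmp)
    | lamK Q =>
      simp only [invK_lamK, invQ_appK, Tgt.wk, Tgt.rename, invQ_rename, invW_var]
      -- For an abstraction the `η`-redex is also a `β`-redex below the binder, so `β_let` with a
      -- variable as value suffices.
      refine .nf_letJ ?_ (.refl _)
      have := star_nf_letJ_ofVal (invQ Q).wk₁ (.var 0)
      rwa [wk₁_inst_zero] at this
  | lamC _ ih => exact .nf_mu_congr ih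
  | appWL _ ih => exact .app (.ofVal ih) (.refl _)
  | appWR _ ih => exact .app (.refl _) (.ofVal ih)
  | appKL _ ih => exact ih _
  | @appKR K W W' _ ih =>
    exact Star.invK (M := ofVal (invW W)) (M' := ofVal (invW W')) (.ofVal ih) K
  | appTL _ ih => exact .invK ih _
  | appTR _ ih => exact ih _
  | lamW _ ih => exact .lam ih
  | lamK _ ih => exact fun M => .nf_letJ ih (.refl _)

/-- `star_colon` reduces `[k]M` with `k` fresh, and `Star.nf_mu` turns this into a reduction of `M`.
-/
theorem star_cps (M : Src .term) : Star Rule M (nf (invT (cps M))) := by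
  have := star_colon M.wkC (.cvar 0)
  rw [nfK_cvar] at this
  exact this.nf_mu.trans (.of_eq (by simp only [cps, invT_lamC, nf, nf_nf]))

theorem star_of_betaEta {M : Src .term} {N : Tgt .T}
    (h : Relation.ReflTransGen BetaEta (cps M) N) : Star Rule M (nf (invT N)) := by
  induction h with
  | refl => exact star_cps M
  | tail _ h ih => exact ih.trans (invRed_of_betaEta h)

end CCV

theorem mainTheorem1 (M : CCV.Src CCV.SrcSort.term) (N : CCV.Tgt CCV.TgtSort.T)
    (h : Relation.ReflTransGen CCV.BetaEta (CCV.cps M) N) :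
    ∃ D : CCV.Expr CCV.SrcSort.term,
      CCV.IsVerticalNF (CCV.invTerm N) D ∧
      (∀ D', CCV.IsVerticalNF (CCV.invTerm N) D' → D' = D) ∧
      Relation.ReflTransGen CCV.Red (CCV.Expr.mk M) D :=
  ⟨CCV.Expr.mk (CCV.Src.nf (CCV.invT N)), CCV.isVerticalNF_nf (CCV.invT N),
    fun _ hD => CCV.IsVerticalNF.eq_nf (M := CCV.invT N) hD, (CCV.star_of_betaEta h).stepOf⟩
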